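/- Let $p$ be a prime, let $\mathbf{C}_p$ be the completion of an algebraic closure of $\mathbf{Q}_p$, let $\overline{\mathbf{Q}}\subset\mathbf{C}_p$ be the algebraic closure of $\mathbf{Q}$ in $\mathbf{C}_p$, let $\log_p\colon\mathbf{C}_p^*\to\mathbf{C}_p$ be Iwasawa's $p$-adic logarithm (so $\log_p(p)=0$), and put $\mathscr{L}_p=\{\log_p(x) : x\in\overline{\mathbf{Q}}^*\}$. Assume the $p$-adic Matrix Coefficient Conjecture: for every $n$ and every $M\in M_{n\times n}(\mathscr{L}_p)$ with $\det(M)=0$ there exist nonzero vectors $w,v\in\mathbf{Q}^n$ such that $\langle w,Mv\rangle=0$, where $\langle\ ,\ \rangle$ is the dot product. Then the Gross–Kuz'min conjecture holds at $p$ for all CM fields, in the following form. Let $F$ be a CM field with maximal totally real subfield $F^+$ and complex conjugation $c$. Let $U=\mathcal{O}_F[1/p]^*\otimes_{\mathbf{Z}}\mathbf{Q}$ and let $U^-\subset U$ be the subspace on which $c$ acts by $-1$. For an embedding $\iota\colon F\to\mathbf{C}_p$ let $F_\iota=\mathbf{Q}_p\cdot\iota(F)\subset\mathbf{C}_p$,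 i.e. the completion of $F$ at the prime above $p$ determined by $\iota$. (1) Gross's regulator map \[ \mathrm{gr}_p\colon U^-\otimes_{\mathbf{Q}}\mathbf{C}_p\longrightarrow\bigoplus_{\iota\colon F\to\mathbf{C}_p}\mathbf{C}_p,\qquad u\mapsto\bigl(\log_p \mathrm{N}_{F_\iota/\mathbf{Q}_p}(\iota(u))\bigr)_\iota \] is injective, and its image has dimension equal to the number of primes of $F^+$ above $p$ that split in $F$. (2) Suppose moreover that $F/\mathbf{Q}$ is Galois with group $G$. Fix an embedding $\iota\colon F\to\mathbf{C}_p$, let $\mathfrak{p}$ be the corresponding prime of $F$ above $p$, and let $F_{\mathfrak{p}}=F_\iota$. Then Gross's regulator map \[ \mathrm{gr}_p\colon U^-\otimes_{\mathbf{Q}}\mathbf{C}_p\longrightarrow\bigoplus_{\tau\in G}\mathbf{C}_p,\qquad u\mapsto\bigl(\log_p \mathrm{N}_{F_{\mathfrak{p}}/\mathbf{Q}_p}(\tau^{-1}(u))\bigr)_\tau \] is injective; and if every prime of $F^+$ above $p$ splits in $F$, then its image has dimension $r$, the number of primes of $F^+$ above $p$. -/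

import Mathlib

open scoped TensorProduct NumberField Topology
open Filter

noncomputable section

namespace GrossKuzmin

/-! ### Iwasawa's `p`-adic logarithm on `ℂ_[p]` -/

section IwasawaLog

variable (p : ℕ) [Fact p.Prime]

/-- The series `∑_{m ≥ 1} (-1)^(m-1) z^m / m`, i.e. `log (1 + z)` for `‖z‖ < 1`. -/
def logSeries (z : ℂ_[p]) : ℂ_[p] :=
  ∑' m : ℕ, (-1) ^ m * z ^ (m + 1) / ((m : ℂ_[p]) + 1)

open Classical in
/-- Iwasawa's logarithm: the extension of `log (1 + z) = z - z^2/2 + ⋯` to `ℂ_[p]ˣ` with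
`log p = 0`. Every `x ≠ 0` has a power of the form `x ^ n = p ^ k * (1 + z)` with `n > 0` and
`‖z‖ < 1`, and then `log x = log (1 + z) / n`; see `iwasawaLog_eq` for the independence of the
choice and `exists_oneUnit` for the existence. (The value at `0` is `0` and plays no role.) -/
def iwasawaLog (x : ℂ_[p]) : ℂ_[p] :=
  if h : ∃ a : ℕ × ℤ, 0 < a.1 ∧ ‖x ^ a.1 * (p : ℂ_[p]) ^ (-a.2) - 1‖ < 1 then
    logSeries p (x ^ h.choose.1 * (p : ℂ_[p]) ^ (-h.choose.2) - 1) / (h.choose.1 : ℂ_[p])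
  else 0

theorem norm_natCast_le_one (n : ℕ) : ‖(n : ℂ_[p])‖ ≤ 1 := by
  have h := PadicComplex.norm_extends' p (n : ℚ_[p])
  have h2 : ((((n : ℚ_[p]) : PadicAlgCl p)) : ℂ_[p]) = (n : ℂ_[p]) := by simp
  rw [h2] at h
  rw [h]
  exact Padic.norm_int_le_one n

theorem norm_p : ‖(p : ℂ_[p])‖ = (p : ℝ)⁻¹ := by
  have h := PadicComplex.norm_extends' p (p : ℚ_[p])
  have h2 : ((((p : ℚ_[p]) : PadicAlgCl p)) : ℂ_[p]) = (p : ℂ_[p]) := by simp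
  rw [h2] at h
  rw [h]
  exact Padic.norm_p

theorem norm_p_lt_one : ‖(p : ℂ_[p])‖ < 1 := by
  rw [norm_p]
  exact inv_lt_one_of_one_lt₀ (by exact_mod_cast (Fact.out : p.Prime).one_lt)

theorem p_ne_zero : (p : ℂ_[p]) ≠ 0 := by
  exact_mod_cast (Fact.out : p.Prime).ne_zero

theorem tendsto_p_pow : Tendsto (fun n : ℕ => ((p ^ n : ℕ) : ℂ_[p])) atTop (𝓝 0) := by
  simp only [Nat.cast_pow]
  exact tendsto_pow_atTop_nhds_zero_of_norm_lt_one (norm_p_lt_one p)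

theorem norm_inv_natCast_le (m : ℕ) : ‖((m : ℂ_[p]) + 1)⁻¹‖ ≤ (m : ℝ) + 1 := by
  have h := PadicComplex.norm_extends' p ((m + 1 : ℕ) : ℚ_[p])
  have h2 : (((((m + 1 : ℕ) : ℚ_[p]) : PadicAlgCl p)) : ℂ_[p]) = (m : ℂ_[p]) + 1 := by
    rw [map_natCast, PadicComplex.coe_natCast, Nat.cast_succ]
  rw [h2] at h
  rw [norm_inv, h]
  rw [Padic.norm_eq_zpow_neg_valuation (by exact_mod_cast Nat.succ_ne_zero m),
    zpow_neg, inv_inv, Padic.valuation_natCast, zpow_natCast]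
  have : p ^ padicValNat p (m + 1) ≤ m + 1 :=
    Nat.le_of_dvd (Nat.succ_pos m) pow_padicValNat_dvd
  exact_mod_cast this

theorem tendsto_choose (m : ℕ) :
    Tendsto (fun n : ℕ => ((p ^ n - 1).choose m : ℂ_[p])) atTop (𝓝 ((-1) ^ m)) := by
  induction m with
  | zero => simp
  | succ m ih =>
    have hne : (m : ℂ_[p]) + 1 ≠ 0 := by exact_mod_cast Nat.succ_ne_zero m
    have h : ∀ n : ℕ, ((p ^ n - 1).choose (m + 1) : ℂ_[p]) =
        ((p ^ n : ℕ) : ℂ_[p]) * ((p ^ n - 1).choose m : ℂ_[p]) / ((m : ℂ_[p]) + 1)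
          - ((p ^ n - 1).choose m : ℂ_[p]) := by
      intro n
      obtain ⟨N, hN⟩ : ∃ N, p ^ n = N + 1 :=
        Nat.exists_eq_succ_of_ne_zero (pow_ne_zero n (Fact.out : p.Prime).ne_zero)
      rw [hN, Nat.add_sub_cancel]
      have h1 : ((N + 1 : ℕ) : ℂ_[p]) * (N.choose m : ℂ_[p]) =
          ((N + 1).choose (m + 1) : ℂ_[p]) * ((m : ℂ_[p]) + 1) := by
        exact_mod_cast Nat.add_one_mul_choose_eq N m
      rw [h1, mul_div_assoc, div_self hne, mul_one, Nat.choose_succ_succ]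
      push_cast
      ring
    simp only [h]
    have := (((tendsto_p_pow p).mul ih).div_const ((m : ℂ_[p]) + 1)).sub ih
    simpa [pow_succ] using this

/-- `log (1 + z)` is the limit of `((1 + z) ^ (p ^ n) - 1) / p ^ n`. -/
theorem tendsto_logSeries {z : ℂ_[p]} (hz : ‖z‖ < 1) :
    Tendsto (fun n : ℕ => ((1 + z) ^ (p ^ n) - 1) / ((p ^ n : ℕ) : ℂ_[p])) atTop
      (𝓝 (logSeries p z)) := by
  have key : ∀ n : ℕ, ((1 + z) ^ (p ^ n) - 1) / ((p ^ n : ℕ) : ℂ_[p]) =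
      ∑' m : ℕ, ((p ^ n - 1).choose m : ℂ_[p]) * z ^ (m + 1) / ((m : ℂ_[p]) + 1) := by
    intro n
    obtain ⟨N, hN⟩ : ∃ N, p ^ n = N + 1 :=
      Nat.exists_eq_succ_of_ne_zero (pow_ne_zero n (Fact.out : p.Prime).ne_zero)
    rw [hN, Nat.add_sub_cancel]
    have hNne : ((N + 1 : ℕ) : ℂ_[p]) ≠ 0 := by exact_mod_cast Nat.succ_ne_zero N
    rw [tsum_eq_sum (s := Finset.range (N + 1))]
    · rw [div_eq_iff hNne, add_comm (1 : ℂ_[p]) z, add_pow, Finset.sum_range_succ']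
      simp only [one_pow, mul_one, pow_zero, Nat.choose_zero_right, Nat.cast_one,
        add_sub_cancel_right]
      rw [Finset.sum_mul]
      refine Finset.sum_congr rfl fun m _ => ?_
      have hne : (m : ℂ_[p]) + 1 ≠ 0 := by exact_mod_cast Nat.succ_ne_zero m
      have h1 : ((N + 1 : ℕ) : ℂ_[p]) * (N.choose m : ℂ_[p]) =
          ((N + 1).choose (m + 1) : ℂ_[p]) * ((m : ℂ_[p]) + 1) := by
        exact_mod_cast Nat.add_one_mul_choose_eq N m
      rw [div_mul_eq_mul_div, eq_div_iff hne]
      linear_combination (-z ^ (m + 1)) * h1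
    · intro m hm
      rw [Nat.choose_eq_zero_of_lt (by simpa using hm)]
      simp
  simp only [key]
  unfold logSeries
  refine tendsto_tsum_of_dominated_convergence
    (bound := fun m : ℕ => ((m : ℝ) + 1) * ‖z‖ ^ (m + 1)) ?_ ?_ ?_
  · have h := summable_pow_mul_geometric_of_norm_lt_one (R := ℝ) 1 (r := ‖z‖) (by simpa using hz)
    have := (summable_nat_add_iff 1).2 h
    simpa using this
  · intro m
    exact ((tendsto_choose p m).mul_const _).div_const _
  · refine Eventually.of_forall fun n m => ?_
    rw [div_eq_mul_inv, norm_mul, norm_mul, norm_pow, mul_comm]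
    have h1 := norm_natCast_le_one p ((p ^ n - 1).choose m)
    have h2 := norm_inv_natCast_le p m
    gcongr
    exact mul_le_of_le_one_left (by positivity) h1

theorem norm_add_lt {x y : ℂ_[p]} (hx : ‖x‖ < 1) (hy : ‖y‖ < 1) : ‖x + y‖ < 1 :=
  (PadicComplex.isNonarchimedean p x y).trans_lt (max_lt hx hy)

theorem norm_mul_sub_one_lt {a b : ℂ_[p]} (ha : ‖a - 1‖ < 1) (hb : ‖b - 1‖ < 1) :
    ‖a * b - 1‖ < 1 := by
  have h : a * b - 1 = ((a - 1) * (b - 1) + (a - 1)) + (b - 1) := by ring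
  rw [h]
  refine norm_add_lt p (norm_add_lt p ?_ ha) hb
  rw [norm_mul]
  exact mul_lt_one_of_nonneg_of_lt_one_left (norm_nonneg _) ha hb.le

theorem norm_pow_sub_one_lt {a : ℂ_[p]} (ha : ‖a - 1‖ < 1) (n : ℕ) : ‖a ^ n - 1‖ < 1 := by
  induction n with
  | zero => simp
  | succ n ih => rw [pow_succ]; exact norm_mul_sub_one_lt p ih ha

theorem logSeries_mul {a b : ℂ_[p]} (ha : ‖a - 1‖ < 1) (hb : ‖b - 1‖ < 1) :
    logSeries p (a * b - 1) = logSeries p (a - 1) + logSeries p (b - 1) := by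
  have hA := tendsto_logSeries p ha
  have hB := tendsto_logSeries p hb
  have hAB := tendsto_logSeries p (norm_mul_sub_one_lt p ha hb)
  simp only [add_sub_cancel] at hA hB hAB
  refine tendsto_nhds_unique hAB ?_
  have hq : ∀ n : ℕ, ((p ^ n : ℕ) : ℂ_[p]) ≠ 0 := fun n => by
    exact_mod_cast pow_ne_zero n (Fact.out : p.Prime).ne_zero
  have hfun : ∀ n : ℕ, ((a * b) ^ (p ^ n) - 1) / ((p ^ n : ℕ) : ℂ_[p]) =
      (a ^ (p ^ n) - 1) / ((p ^ n : ℕ) : ℂ_[p]) *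
        (((p ^ n : ℕ) : ℂ_[p]) * ((b ^ (p ^ n) - 1) / ((p ^ n : ℕ) : ℂ_[p])) + 1)
        + (b ^ (p ^ n) - 1) / ((p ^ n : ℕ) : ℂ_[p]) := by
    intro n
    have := hq n
    rw [mul_pow]
    field_simp
    ring
  simp only [hfun]
  have := (hA.mul (((tendsto_p_pow p).mul hB).add_const 1)).add hB
  simpa using this

theorem logSeries_pow {a : ℂ_[p]} (ha : ‖a - 1‖ < 1) (n : ℕ) :
    logSeries p (a ^ n - 1) = n * logSeries p (a - 1) := by
  induction n with
  | zero => simp [logSeries]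
  | succ n ih =>
    rw [pow_succ, logSeries_mul p (norm_pow_sub_one_lt p ha n) ha, ih]
    push_cast
    ring

theorem norm_eq_one_of_sub {a : ℂ_[p]} (ha : ‖a - 1‖ < 1) : ‖a‖ = 1 := by
  have h1 : ‖a‖ ≤ 1 := by
    have := PadicComplex.isNonarchimedean p (a - 1) 1
    rw [sub_add_cancel, norm_one] at this
    exact this.trans (max_le ha.le le_rfl)
  refine le_antisymm h1 (not_lt.1 fun h => ?_)
  have := norm_add_lt p (x := -(a - 1)) (y := a) (by rwa [norm_neg]) h
  rw [neg_sub, sub_add_cancel, norm_one] at this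
  exact lt_irrefl _ this

/-- The value of the logarithm does not depend on the choices made in its definition. -/
theorem iwasawaLog_eq {x : ℂ_[p]} {n : ℕ} {k : ℤ} (hn : 0 < n)
    (h : ‖x ^ n * (p : ℂ_[p]) ^ (-k) - 1‖ < 1) :
    iwasawaLog p x = logSeries p (x ^ n * (p : ℂ_[p]) ^ (-k) - 1) / (n : ℂ_[p]) := by
  have hex : ∃ a : ℕ × ℤ, 0 < a.1 ∧ ‖x ^ a.1 * (p : ℂ_[p]) ^ (-a.2) - 1‖ < 1 := ⟨(n, k), hn, h⟩
  unfold iwasawaLog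
  rw [dif_pos hex]
  obtain ⟨hm, hl⟩ := hex.choose_spec
  generalize hex.choose.1 = m at hm hl ⊢
  generalize hex.choose.2 = l at hl ⊢
  have hp0 := p_ne_zero p
  have hx0 : x ≠ 0 := by
    rintro rfl
    rw [zero_pow hn.ne', zero_mul, zero_sub, norm_neg, norm_one] at h
    exact lt_irrefl _ h
  have hmul : (x ^ m * (p : ℂ_[p]) ^ (-l)) ^ n =
      (x ^ n * (p : ℂ_[p]) ^ (-k)) ^ m * (p : ℂ_[p]) ^ (k * m - l * n) := by
    rw [mul_pow, mul_pow, ← pow_mul, ← pow_mul, mul_comm m n, ← zpow_natCast, ← zpow_natCast,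
      ← zpow_natCast, ← zpow_mul, ← zpow_mul, mul_assoc, ← zpow_add₀ hp0]
    congr 2
    ring
  have hnorm : ‖(p : ℂ_[p]) ^ (k * m - l * n)‖ = 1 := by
    have h1 := congrArg norm hmul
    rw [norm_mul, norm_pow, norm_pow, norm_eq_one_of_sub p hl, norm_eq_one_of_sub p h, one_pow,
      one_pow, one_mul] at h1
    exact h1.symm
  have hexp : k * m - l * n = 0 := by
    rw [norm_zpow] at hnorm
    exact (zpow_eq_one_iff_right₀ (norm_nonneg _) (norm_p_lt_one p).ne).1 hnorm
  rw [hexp, zpow_zero, mul_one] at hmul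
  have h2 := logSeries_pow p hl n
  rw [hmul, logSeries_pow p h m] at h2
  have hn' : (n : ℂ_[p]) ≠ 0 := by exact_mod_cast hn.ne'
  have hm' : (m : ℂ_[p]) ≠ 0 := by exact_mod_cast hm.ne'
  rw [div_eq_div_iff hm' hn']
  linear_combination -h2

/-- An algebraic element over `ℚ_[p]` has a power of the form `p ^ k * (1 + z)`, `‖z‖ < 1`. -/
theorem exists_oneUnit_algCl {y : PadicAlgCl p} (hy : y ≠ 0) :
    ∃ a : ℕ × ℤ, 0 < a.1 ∧ ‖y ^ a.1 * (p : PadicAlgCl p) ^ (-a.2) - 1‖ < 1 := by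
  have hp1 : 1 < (p : ℝ) := by exact_mod_cast (Fact.out : p.Prime).one_lt
  have hpn : ‖(p : PadicAlgCl p)‖ = (p : ℝ)⁻¹ := by
    have h := PadicAlgCl.norm_extends p (p : ℚ_[p])
    rw [Padic.norm_p] at h
    rw [← h]
    simp
  have hp0 : (p : PadicAlgCl p) ≠ 0 := by
    exact_mod_cast (Fact.out : p.Prime).ne_zero
  let E : IntermediateField ℚ_[p] (PadicAlgCl p) := IntermediateField.adjoin ℚ_[p] {y}
  have hfin : FiniteDimensional ℚ_[p] E :=
    IntermediateField.adjoin.finiteDimensional (Algebra.IsIntegral.isIntegral y)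
  have hprop : ProperSpace E := FiniteDimensional.proper ℚ_[p] E
  let y' : E := ⟨y, IntermediateField.mem_adjoin_simple_self ℚ_[p] y⟩
  -- normalise every power of `y` to have norm in `(1/p, 1]`
  have hch : ∀ m : ℕ, ∃ k : ℤ, (p : ℝ)⁻¹ < ‖y ^ m * (p : PadicAlgCl p) ^ (-k)‖ ∧
      ‖y ^ m * (p : PadicAlgCl p) ^ (-k)‖ ≤ 1 := by
    intro m
    have hpos : 0 < ‖y ^ m‖ := norm_pos_iff.2 (pow_ne_zero m hy)
    obtain ⟨k, hk1, hk2⟩ := exists_mem_Ioc_zpow hpos hp1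
    refine ⟨-(k + 1), ?_, ?_⟩
    · rw [norm_mul, norm_zpow, hpn, neg_neg, inv_zpow, ← div_eq_mul_inv,
        lt_div_iff₀ (by positivity), zpow_add_one₀ (by positivity)]
      rw [mul_comm, mul_assoc, mul_inv_cancel₀ (by positivity), mul_one]
      exact hk1
    · rw [norm_mul, norm_zpow, hpn, neg_neg, inv_zpow, ← div_eq_mul_inv]
      exact div_le_one_of_le₀ hk2 (by positivity)
  choose k hk1 hk2 using hch
  let s : ℕ → E := fun m => y' ^ m * (p : E) ^ (-k m)
  have hs : ∀ m, ((s m : E) : PadicAlgCl p) = y ^ m * (p : PadicAlgCl p) ^ (-k m) := by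
    intro m
    change algebraMap E (PadicAlgCl p) (y' ^ m * (p : E) ^ (-k m)) = _
    rw [map_mul, map_pow, map_zpow₀, map_natCast]
    rfl
  have hmem : ∀ m, s m ∈ Metric.closedBall (0 : E) 1 := by
    intro m
    rw [mem_closedBall_zero_iff]
    change ‖((s m : E) : PadicAlgCl p)‖ ≤ 1
    rw [hs]
    exact hk2 m
  obtain ⟨a, _, φ, hφ, hlim⟩ := (isCompact_closedBall (0 : E) 1).tendsto_subseq hmem
  have hcau := hlim.cauchySeq
  rw [Metric.cauchySeq_iff'] at hcau
  obtain ⟨N, hN⟩ := hcau (p : ℝ)⁻¹ (by positivity)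
  have h1 := hN (N + 1) (Nat.le_succ N)
  rw [dist_eq_norm] at h1
  change ‖((s (φ (N + 1)) : E) : PadicAlgCl p) - ((s (φ N) : E) : PadicAlgCl p)‖ < _ at h1
  rw [hs, hs] at h1
  have hlt : φ N < φ (N + 1) := hφ (Nat.lt_succ_self N)
  generalize φ (N + 1) = m at h1 hlt
  generalize φ N = n at h1 hlt
  refine ⟨(m - n, k m - k n), Nat.sub_pos_of_lt hlt, ?_⟩
  have hb : y ^ n * (p : PadicAlgCl p) ^ (-k n) ≠ 0 := by positivity
  have hratio : y ^ (m - n) * (p : PadicAlgCl p) ^ (-(k m - k n)) - 1 =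
      (y ^ m * (p : PadicAlgCl p) ^ (-k m) - y ^ n * (p : PadicAlgCl p) ^ (-k n)) /
        (y ^ n * (p : PadicAlgCl p) ^ (-k n)) := by
    rw [eq_div_iff hb, sub_mul, one_mul]
    congr 1
    have e1 : y ^ m = y ^ (m - n) * y ^ n := by rw [← pow_add, Nat.sub_add_cancel hlt.le]
    have e2 : (p : PadicAlgCl p) ^ (-k m) =
        (p : PadicAlgCl p) ^ (-(k m - k n)) * (p : PadicAlgCl p) ^ (-k n) := by
      rw [← zpow_add₀ hp0]
      congr 1
      ring
    rw [e1, e2]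
    ring
  change ‖y ^ (m - n) * (p : PadicAlgCl p) ^ (-(k m - k n)) - 1‖ < 1
  rw [hratio, norm_div, div_lt_one (norm_pos_iff.2 hb)]
  exact h1.trans (hk1 n)

/-- Every `x ≠ 0` in `ℂ_[p]` has a power of the form `p ^ k * (1 + z)` with `‖z‖ < 1`. -/
theorem exists_oneUnit {x : ℂ_[p]} (hx : x ≠ 0) :
    ∃ a : ℕ × ℤ, 0 < a.1 ∧ ‖x ^ a.1 * (p : ℂ_[p]) ^ (-a.2) - 1‖ < 1 := by
  have hxpos : 0 < ‖x‖ := norm_pos_iff.2 hx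
  obtain ⟨y, hy⟩ := (UniformSpace.Completion.denseRange_coe (α := PadicAlgCl p)).exists_dist_lt
    x hxpos
  rw [dist_eq_norm] at hy
  have hy0 : y ≠ 0 := by
    rintro rfl
    simp at hy
  obtain ⟨⟨n, k⟩, hn, hnk⟩ := exists_oneUnit_algCl p hy0
  have hyc0 : (y : ℂ_[p]) ≠ 0 := by
    rw [← norm_ne_zero_iff, PadicComplex.norm_extends]
    exact norm_ne_zero_iff.2 hy0
  have hnorm : ‖(y : ℂ_[p])‖ = ‖x‖ := by
    have h1 : ‖(y : ℂ_[p])‖ ≤ ‖x‖ := by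
      have := PadicComplex.isNonarchimedean p (-(x - (y : ℂ_[p]))) x
      rw [neg_sub, sub_add_cancel, norm_sub_rev] at this
      exact this.trans (max_le hy.le le_rfl)
    refine le_antisymm h1 (not_lt.1 fun h => ?_)
    have := PadicComplex.isNonarchimedean p (x - (y : ℂ_[p])) (y : ℂ_[p])
    rw [sub_add_cancel] at this
    exact lt_irrefl _ (this.trans_lt (max_lt hy h))
  have hu : ‖x / (y : ℂ_[p]) - 1‖ < 1 := by
    rw [div_sub_one hyc0, norm_div, hnorm, div_lt_one hxpos]
    exact hy
  have hv : ‖(y : ℂ_[p]) ^ n * (p : ℂ_[p]) ^ (-k) - 1‖ < 1 := by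
    have h := PadicComplex.norm_extends p (y ^ n * (p : PadicAlgCl p) ^ (-k) - 1)
    rw [PadicComplex.coe_eq] at h
    rw [map_sub, map_mul, map_pow, map_zpow₀, map_natCast, map_one, ← PadicComplex.coe_eq] at h
    rw [h]
    exact hnk
  refine ⟨(n, k), hn, ?_⟩
  have e : x ^ n * (p : ℂ_[p]) ^ (-k) =
      (x / (y : ℂ_[p])) ^ n * ((y : ℂ_[p]) ^ n * (p : ℂ_[p]) ^ (-k)) := by
    rw [div_pow]
    field_simp
  change ‖x ^ n * (p : ℂ_[p]) ^ (-k) - 1‖ < 1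
  rw [e]
  exact norm_mul_sub_one_lt p (norm_pow_sub_one_lt p hu n) hv

theorem iwasawaLog_mul {x y : ℂ_[p]} (hx : x ≠ 0) (hy : y ≠ 0) :
    iwasawaLog p (x * y) = iwasawaLog p x + iwasawaLog p y := by
  obtain ⟨⟨n, k⟩, hn, hu⟩ := exists_oneUnit p hx
  obtain ⟨⟨m, l⟩, hm, hv⟩ := exists_oneUnit p hy
  dsimp only at hn hu hm hv
  have hp0 := p_ne_zero p
  have e : (x * y) ^ (n * m) * (p : ℂ_[p]) ^ (-(k * m + l * n)) =
      (x ^ n * (p : ℂ_[p]) ^ (-k)) ^ m * (y ^ m * (p : ℂ_[p]) ^ (-l)) ^ n := by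
    have e1 : (p : ℂ_[p]) ^ (-(k * m + l * n)) =
        ((p : ℂ_[p]) ^ (-k)) ^ m * ((p : ℂ_[p]) ^ (-l)) ^ n := by
      rw [← zpow_natCast, ← zpow_natCast, ← zpow_mul, ← zpow_mul, ← zpow_add₀ hp0]
      congr 1
      ring
    rw [e1]
    ring
  have hw : ‖(x * y) ^ (n * m) * (p : ℂ_[p]) ^ (-(k * m + l * n)) - 1‖ < 1 := by
    rw [e]
    exact norm_mul_sub_one_lt p (norm_pow_sub_one_lt p hu m) (norm_pow_sub_one_lt p hv n)
  rw [iwasawaLog_eq p (Nat.mul_pos hn hm) hw, iwasawaLog_eq p hn hu, iwasawaLog_eq p hm hv, e,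
    logSeries_mul p (norm_pow_sub_one_lt p hu m) (norm_pow_sub_one_lt p hv n),
    logSeries_pow p hu, logSeries_pow p hv]
  have hn' : (n : ℂ_[p]) ≠ 0 := by exact_mod_cast hn.ne'
  have hm' : (m : ℂ_[p]) ≠ 0 := by exact_mod_cast hm.ne'
  push_cast
  field_simp

theorem iwasawaLog_one : iwasawaLog p 1 = 0 := by
  have h := iwasawaLog_mul p (one_ne_zero : (1 : ℂ_[p]) ≠ 0) one_ne_zero
  rw [mul_one] at h
  simpa using h

end IwasawaLog

/-! ### The `p`-adic Matrix Coefficient Conjecture -/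

section MatrixCoefficient

variable (p : ℕ) [Fact p.Prime]

/-- `𝓛_p`: the set of logarithms `log_p x` of nonzero algebraic numbers `x ∈ ℚ̄ ⊆ ℂ_[p]`, where
`ℚ̄` is the algebraic closure of `ℚ` in `ℂ_[p]`. -/
def logAlg : Set ℂ_[p] :=
  {l | ∃ x : ℂ_[p], x ≠ 0 ∧ IsAlgebraic ℚ x ∧ l = iwasawaLog p x}

/-- The `p`-adic Matrix Coefficient Conjecture: for every square matrix `M` over `𝓛_p` with
`det M = 0` there are nonzero rational vectors `w`, `v` with `⟨w, M v⟩ = 0`. -/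
def MatrixCoefficientConjecture : Prop :=
  ∀ (n : ℕ) (M : Matrix (Fin n) (Fin n) ℂ_[p]), (∀ i j, M i j ∈ logAlg p) → M.det = 0 →
    ∃ w v : Fin n → ℚ, w ≠ 0 ∧ v ≠ 0 ∧
      (fun i => (w i : ℂ_[p])) ⬝ᵥ (M.mulVec fun j => (v j : ℂ_[p])) = 0

end MatrixCoefficient

/-! ### `p`-units and Gross's regulator -/

section Regulator

variable (p : ℕ) (F : Type*) [Field F]

/-- The group of `p`-units `𝓞_F[1/p]ˣ`, as a subgroup of `Fˣ`. -/
def pUnits : Subgroup Fˣ :=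
  (Algebra.adjoin (𝓞 F) {((p : F))⁻¹}).toSubmonoid.units

variable {F} in
theorem map_mem_adjoin (σ : F →+* F) {x : F} (hx : x ∈ Algebra.adjoin (𝓞 F) {((p : F))⁻¹}) :
    σ x ∈ Algebra.adjoin (𝓞 F) {((p : F))⁻¹} := by
  induction hx using Algebra.adjoin_induction with
  | mem x hx =>
    rw [Set.mem_singleton_iff] at hx
    subst hx
    rw [map_inv₀, map_natCast]
    exact Algebra.subset_adjoin rfl
  | algebraMap r =>
    exact Subalgebra.algebraMap_mem (Algebra.adjoin (𝓞 F) {((p : F))⁻¹})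
      (NumberField.RingOfIntegers.mapRingHom σ r)
  | add x y _ _ hx hy => rw [map_add]; exact add_mem hx hy
  | mul x y _ _ hx hy => rw [map_mul]; exact mul_mem hx hy

variable {F} in
/-- The action of an endomorphism of `F` on the `p`-units. -/
def pUnitsMap (σ : F →+* F) : pUnits p F →* pUnits p F :=
  ((Units.map (σ : F →* F)).comp (pUnits p F).subtype).codRestrict (pUnits p F) fun u => by
    have hu := (Submonoid.mem_units_iff _ _).1 u.2
    refine (Submonoid.mem_units_iff _ _).2 ⟨map_mem_adjoin p σ hu.1, ?_⟩
    rw [← map_inv]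
    exact map_mem_adjoin p σ hu.2

/-- `U = 𝓞_F[1/p]ˣ ⊗_ℤ ℚ`. -/
abbrev PUnitsQ : Type _ := ℚ ⊗[ℤ] Additive (pUnits p F)

/-- `U⁻`: the subspace of `U` on which complex conjugation `c` acts by `-1`. -/
def minusPart [NumberField F] [NumberField.IsCMField F] : Submodule ℚ (PUnitsQ p F) :=
  LinearMap.ker
    (LinearMap.baseChange ℚ (MonoidHom.toAdditive
      (pUnitsMap p (NumberField.IsCMField.complexConj F : F →+* F))).toIntLinearMap
      + LinearMap.id)

variable {F} [Fact p.Prime]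

/-- The completion `F_𝔭` of `F` at the prime `𝔭` above `p` determined by an embedding
`ι : F → ℂ_[p]`, realised inside `ℂ_[p]` as the compositum `ℚ_[p] · ι(F)`. -/
abbrev localField (ι : F →+* ℂ_[p]) : IntermediateField ℚ_[p] ℂ_[p] :=
  IntermediateField.adjoin ℚ_[p] (Set.range ι)

/-- The local norm `x ↦ N_{F_𝔭/ℚ_p} x ∈ ℚ_[p]`, for `𝔭` determined by `ι : F → ℂ_[p]`. -/
def localNorm (ι : F →+* ℂ_[p]) (x : F) : ℚ_[p] :=
  Algebra.norm ℚ_[p]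
    (⟨ι x, IntermediateField.subset_adjoin ℚ_[p] _ (Set.mem_range_self x)⟩ : localField p ι)

theorem localNorm_one (ι : F →+* ℂ_[p]) : localNorm p ι 1 = 1 := by
  unfold localNorm
  rw [← map_one (Algebra.norm ℚ_[p] (S := localField p ι))]
  congr 1
  exact Subtype.ext (map_one ι)

theorem localNorm_mul (ι : F →+* ℂ_[p]) (x y : F) :
    localNorm p ι (x * y) = localNorm p ι x * localNorm p ι y := by
  unfold localNorm
  rw [← map_mul]
  congr 1
  exact Subtype.ext (map_mul ι x y)

theorem localNorm_ne_zero (ι : F →+* ℂ_[p]) (u : Fˣ) : localNorm p ι (u : F) ≠ 0 := by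
  intro h
  have h1 := localNorm_mul p ι (u : F) ((u⁻¹ : Fˣ) : F)
  rw [Units.mul_inv, localNorm_one, h, zero_mul] at h1
  exact one_ne_zero h1

/-- The homomorphism `u ↦ log_p (N_{F_𝔭/ℚ_p} u)` on `p`-units, for `𝔭` determined by `ι`. -/
def logNorm (ι : F →+* ℂ_[p]) : Additive (pUnits p F) →+ ℂ_[p] where
  toFun u := iwasawaLog p (algebraMap ℚ_[p] ℂ_[p] (localNorm p ι ((u.toMul : Fˣ) : F)))
  map_zero' := by
    simp [localNorm_one, iwasawaLog_one]
  map_add' u v := by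
    rw [toMul_add, Subgroup.coe_mul, Units.val_mul, localNorm_mul, map_mul, iwasawaLog_mul]
    · exact (map_ne_zero _).2 (localNorm_ne_zero p ι _)
    · exact (map_ne_zero _).2 (localNorm_ne_zero p ι _)

variable [NumberField F] [NumberField.IsCMField F]

/-- For homomorphisms `ℓ i : 𝓞_F[1/p]ˣ → ℂ_[p]`, the induced `ℂ_[p]`-linear map
`U⁻ ⊗_ℚ ℂ_[p] → ⨁_i ℂ_[p]`, `u ↦ (ℓ i u)_i`. -/
def regulatorOf {I : Type*} (ℓ : I → (Additive (pUnits p F) →+ ℂ_[p])) :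
    ℂ_[p] ⊗[ℚ] minusPart p F →ₗ[ℂ_[p]] (I → ℂ_[p]) :=
  LinearMap.liftBaseChange ℂ_[p]
    ((LinearMap.pi fun i => LinearMap.liftBaseChange ℚ (ℓ i).toIntLinearMap).comp
      (minusPart p F).subtype)

variable (F) in
/-- Gross's regulator map of the CM field `F`:
`u ↦ (log_p N_{F_𝔭/ℚ_p} u)_ι`, where `ι` runs over all embeddings `F → ℂ_[p]` and `𝔭` is the prime
of `F` above `p` determined by `ι`. (The components of two embeddings with the same `𝔭` agree.) -/
def grossRegulator : ℂ_[p] ⊗[ℚ] minusPart p F →ₗ[ℂ_[p]] ((F →+* ℂ_[p]) → ℂ_[p]) :=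
  regulatorOf p fun ι => logNorm p ι

/-- Gross's regulator map, for a fixed embedding `ι : F → ℂ_[p]` with associated prime `𝔭`:
`u ↦ (log_p N_{F_𝔭/ℚ_p} (τ⁻¹ u))_τ`, where `τ` runs over `Gal(F/ℚ)`. -/
def grossRegulatorGal (ι : F →+* ℂ_[p]) :
    ℂ_[p] ⊗[ℚ] minusPart p F →ₗ[ℂ_[p]] ((F ≃ₐ[ℚ] F) → ℂ_[p]) :=
  regulatorOf p fun τ => (logNorm p ι).comp
    (MonoidHom.toAdditive (pUnitsMap p ((τ⁻¹ : F ≃ₐ[ℚ] F) : F →+* F)))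

end Regulator

/-! ### Primes above `p` -/

section Primes

variable (p : ℕ) (F : Type*) [Field F] [NumberField F]

/-- The set of primes of the maximal totally real subfield `F⁺` above `p`. -/
def realPrimesAbove : Set (Ideal (𝓞 (NumberField.maximalRealSubfield F))) :=
  (Ideal.span {(p : ℤ)}).primesOver (𝓞 (NumberField.maximalRealSubfield F))

variable {F} in
/-- A prime of `F⁺` splits (completely) in the quadratic extension `F` if there are two primes
of `F` above it. -/
def SplitsInCM (v : Ideal (𝓞 (NumberField.maximalRealSubfield F))) : Prop :=
  (v.primesOver (𝓞 F)).ncard = 2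

end Primes

end GrossKuzmin

end

/-!
# The Gross–Kuz'min conjecture from the `p`-adic Matrix Coefficient Conjecture

**Galois case.** Let `F` be a CM field which is Galois over `ℚ` with group `G`, and fix an embedding
`ι : F → ℂ_[p]` with associated prime `𝔭`. On the `ℚ[G]`-module `V = U⁻` the functional
`L = log_p ∘ ι` is injective: if `log_p (ι u) = 0` then some power of `u` is a power of `p`, which
is both fixed and inverted by complex conjugation (`evalQ_logEmb_injective`). The local norm at `𝔭`
is `ι` composed with an element `n` of `ℚ[G]`, the sum of the `τ ∈ G` such that `ι ∘ τ` extends to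
the completion at `𝔭`. So the regulator is the pairing `(w, v) ↦ L (w v)` between the right ideal
`n ℚ[G]` and `V`, and its kernel `K` in `ℂ_[p] ⊗ V` is stable under `ℚ[G]`.

Suppose `K ≠ 0`. As `ℚ[G]` is semisimple, there is an idempotent `e` generating a simple left ideal
with `e K ≠ 0`. Restrict the pairing to `W' = n ℚ[G] e` and `V' = e V`: some nonzero element of
`ℂ_[p] ⊗ V'` is still orthogonal to `W'`. The rational pairing `(w, v) ↦ ord_𝔭 (w v)` has no kernel
on the side of `V`, because elements of `U⁻` with trivial valuations are roots of unity
(`eq_zero_of_ordAt_eq_zero`); hence `dim V' ≤ dim W'`, and the pairing contains a singular square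
matrix of full size `dim V'`. The conjecture gives nonzero `w ∈ W'` and `v ∈ V'` with `L (w v) = 0`,
so `w v = 0`. But `a ↦ a v` is injective on the simple left ideal `ℚ[G] e`, as `e v = v ≠ 0`: a
contradiction. The purely algebraic part of this argument is `eq_zero_of_matrixCoefficient`.

**General case.** A Galois closure `E` of a CM field `F` is a CM field, and the regulator of `E`
restricts to that of `F` up to local degrees (`grossRegulator_injective`).

**Dimension.** By injectivity the image has dimension `dim U⁻`. One valuation above each prime of
`F⁺` that splits in `F` identifies `U⁻` with a space of functions on these primes: injectivity is
again Kronecker's theorem, surjectivity is the finiteness of the class group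
(`finrank_minusPart`).
-/

noncomputable section

namespace GrossKuzmin

/-! ### Rationalised abelian groups -/

section RationalTensor

variable {M : Type*} [AddCommGroup M]

theorem exists_nsmul_eq_one_tmul (v : ℚ ⊗[ℤ] M) : ∃ m : ℕ, m ≠ 0 ∧ ∃ u : M, m • v = 1 ⊗ₜ u := by
  induction v using TensorProduct.induction_on with
  | zero => exact ⟨1, one_ne_zero, 0, by simp⟩
  | tmul q u =>
    refine ⟨q.den, q.den_nz, q.num • u, ?_⟩
    rw [← TensorProduct.smul_tmul, TensorProduct.smul_tmul', nsmul_eq_mul, Rat.den_mul_eq_num,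
      zsmul_eq_mul, mul_one]
  | add v w hv hw =>
    obtain ⟨m, hm, a, ha⟩ := hv
    obtain ⟨n, hn, b, hb⟩ := hw
    refine ⟨m * n, mul_ne_zero hm hn, n • a + m • b, ?_⟩
    rw [smul_add, mul_smul m n w, hb, mul_comm m n, mul_smul, ha, TensorProduct.tmul_add,
      TensorProduct.tmul_smul, TensorProduct.tmul_smul]

theorem one_tmul_eq_zero {u : M} (h : (1 : ℚ) ⊗ₜ[ℤ] u = 0) : ∃ m : ℕ, m ≠ 0 ∧ m • u = 0 := by
  have : IsLocalizedModule (nonZeroDivisors ℤ) (TensorProduct.mk ℤ ℚ M 1) :=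
    (isLocalizedModule_iff_isBaseChange _ ℚ _).2 (TensorProduct.isBaseChange _ _ _)
  have h' : TensorProduct.mk ℤ ℚ M 1 u = TensorProduct.mk ℤ ℚ M 1 0 := by simpa using h
  obtain ⟨c, hc⟩ := IsLocalizedModule.exists_of_eq (S := nonZeroDivisors ℤ) h'
  refine ⟨(c : ℤ).natAbs, Int.natAbs_ne_zero.2 (nonZeroDivisors.ne_zero c.2), ?_⟩
  rw [smul_zero, Submonoid.smul_def] at hc
  rw [← natCast_zsmul]
  rcases Int.natAbs_eq (c : ℤ) with h | h
  · rw [← h, hc]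
  · rw [← neg_eq_iff_eq_neg] at h
    rw [← h, neg_smul, hc, neg_zero]

end RationalTensor

/-! ### Bilinear pairings on modules over semisimple algebras -/

section Semisimple

variable {A : Type*} [Ring A] [Algebra ℚ A]
variable {C : Type*} [Field C] [Algebra ℚ C]
variable {V : Type*} [AddCommGroup V] [Module ℚ V]

/-- If `A e` is a simple left ideal and `e v ≠ 0`, then `a ↦ a v` is injective on `A e`: its kernel
is a left ideal properly contained in `A e`. -/
theorem eq_zero_of_isSimple {e : A} (ρ : A →ₐ[ℚ] Module.End ℚ V)
    (he : IsSimpleModule A (Ideal.span {e})) {a : A} {v : V} (ha : a ∈ Ideal.span {e})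
    (hv : ρ e v ≠ 0) (hav : ρ a v = 0) : a = 0 := by
  let N : Submodule A A :=
    { carrier := {b | ρ b v = 0}
      add_mem' := fun {x y} hx hy => by
        simp only [Set.mem_ofPred_eq, map_add, LinearMap.add_apply] at *
        rw [hx, hy, add_zero]
      zero_mem' := by simp
      smul_mem' := fun c x hx => by
        simp only [Set.mem_ofPred_eq, smul_eq_mul, map_mul, Module.End.mul_apply] at *
        rw [hx, map_zero] }
  have hatom : IsAtom (Ideal.span {e}) := isSimpleModule_iff_isAtom.1 he
  have hlt : N ⊓ Ideal.span {e} < Ideal.span {e} := by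
    refine lt_of_le_of_ne inf_le_right fun h => hv ?_
    have : e ∈ N ⊓ Ideal.span {e} := by
      rw [h]
      exact Ideal.mem_span_singleton_self e
    exact this.1
  have hbot := hatom.2 _ hlt
  have : a ∈ N ⊓ Ideal.span {e} := ⟨hav, ha⟩
  rw [hbot] at this
  simpa using this

theorem liftBaseChange_comp {W : Type*} [AddCommGroup W] [Module ℚ W] (f : W →ₗ[ℚ] C)
    (g : V →ₗ[ℚ] W) :
    LinearMap.liftBaseChange C (f ∘ₗ g) = LinearMap.liftBaseChange C f ∘ₗ g.baseChange C := by
  refine LinearMap.ext fun y => ?_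
  induction y using TensorProduct.induction_on with
  | zero => simp
  | tmul c v => simp
  | add x y hx hy => rw [LinearMap.map_add, LinearMap.map_add, hx, hy]

/-- If a pairing `β : W × V → C` of rational vector spaces with `dim V ≤ dim W` becomes degenerate on
the side of `V` over `C`, and singular square matrices of values of `β` are degenerate in the sense
of the Matrix Coefficient Conjecture, then `β` has a nontrivial rational zero. -/
theorem exists_bilin_eq_zero {W : Type*} [AddCommGroup W] [Module ℚ W]
    [FiniteDimensional ℚ V] (β : W →ₗ[ℚ] V →ₗ[ℚ] C)
    (hdim : Module.finrank ℚ V ≤ Module.finrank ℚ W)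
    (hM : ∀ (m : ℕ) (M : Matrix (Fin m) (Fin m) C), (∀ i j, ∃ w v, M i j = β w v) →
      M.det = 0 → ∃ w v : Fin m → ℚ, w ≠ 0 ∧ v ≠ 0 ∧
        (fun i => algebraMap ℚ C (w i)) ⬝ᵥ (M.mulVec fun j => algebraMap ℚ C (v j)) = 0)
    {y : C ⊗[ℚ] V} (hy : y ≠ 0) (hβ : ∀ w, LinearMap.liftBaseChange C (β w) y = 0) :
    ∃ w v, w ≠ 0 ∧ v ≠ 0 ∧ β w v = 0 := by
  -- the Gram matrix of a basis of `V` and as many independent vectors of `W` kills the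
  -- coordinate vector of `y`
  let b := Module.finBasis ℚ V
  obtain ⟨f, hf⟩ := exists_linearIndependent_of_le_finrank hdim
  let c := (b.baseChange C).repr y
  have hyc : y = ∑ j, c j • ((1 : C) ⊗ₜ[ℚ] b j) := by
    conv_lhs => rw [← (b.baseChange C).sum_repr y]
    exact Finset.sum_congr rfl fun j _ => by rw [Module.Basis.baseChange_apply]
  let M : Matrix (Fin (Module.finrank ℚ V)) (Fin (Module.finrank ℚ V)) C :=
    Matrix.of fun i j => β (f i) (b j)
  have hMc : M.mulVec c = 0 := by
    funext i
    have h := hβ (f i)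
    rw [hyc, map_sum] at h
    rw [Pi.zero_apply, ← h]
    change ∑ j, M i j * c j = _
    refine Finset.sum_congr rfl fun j _ => ?_
    rw [map_smul, LinearMap.liftBaseChange_tmul, one_smul, smul_eq_mul, mul_comm]
    rfl
  have hc : (c : Fin (Module.finrank ℚ V) → C) ≠ 0 := by
    intro hc
    refine hy (hyc.trans (Finset.sum_eq_zero fun j _ => ?_))
    rw [congrFun hc j, Pi.zero_apply, zero_smul]
  have hdet : M.det = 0 := Matrix.exists_mulVec_eq_zero_iff.1 ⟨c, hc, hMc⟩
  obtain ⟨w, v, hw, hv, hwv⟩ := hM _ M (fun i j => ⟨_, _, rfl⟩) hdet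
  refine ⟨∑ i, w i • f i, ∑ j, v j • b j,
    fun h => hw (funext (Fintype.linearIndependent_iff.1 hf w h)),
    fun h => hv (funext (Fintype.linearIndependent_iff.1 b.linearIndependent v h)), ?_⟩
  rw [← hwv, LinearMap.map_sum₂]
  refine Finset.sum_congr rfl fun i _ => ?_
  rw [LinearMap.map_smul₂, map_sum, Algebra.smul_def]
  congr 1
  refine Finset.sum_congr rfl fun j _ => ?_
  rw [map_smul, Algebra.smul_def, mul_comm]
  rfl

/-- Let a semisimple `ℚ`-algebra `A` act on `V`. If `L : V → C` is injective over `ℚ` and its values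
satisfy the Matrix Coefficient Conjecture, then the pairing `(w, v) ↦ L (w v)` between the right ideal
`n A` and `V` is nondegenerate on the side of `V` over `C`, as soon as some rational pairing
`(w, v) ↦ o (w v)` is nondegenerate on that side over `ℚ`. -/
theorem eq_zero_of_matrixCoefficient [FiniteDimensional ℚ A] [IsSemisimpleRing A]
    [FiniteDimensional ℚ V] (ρ : A →ₐ[ℚ] Module.End ℚ V)
    (n : A) (L : V →ₗ[ℚ] C) (hL : Function.Injective L) (o : V →ₗ[ℚ] ℚ)
    (ho : ∀ v, (∀ a, o (ρ (n * a) v) = 0) → v = 0)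
    (hM : ∀ (m : ℕ) (M : Matrix (Fin m) (Fin m) C), (∀ i j, M i j ∈ LinearMap.range L) →
      M.det = 0 → ∃ w v : Fin m → ℚ, w ≠ 0 ∧ v ≠ 0 ∧
        (fun i => algebraMap ℚ C (w i)) ⬝ᵥ (M.mulVec fun j => algebraMap ℚ C (v j)) = 0)
    (x : C ⊗[ℚ] V) (hx : ∀ a, LinearMap.liftBaseChange C (L ∘ₗ ρ (n * a)) x = 0) : x = 0 := by
  -- Idempotents generating simple left ideals kill `x`.
  have key : ∀ e : A, IsIdempotentElem e → IsSimpleModule A (Ideal.span {e}) →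
      (ρ e).baseChange C x = 0 := by
    intro e he hsimple
    let V' : Submodule ℚ V := LinearMap.range (ρ e)
    let W' : Submodule ℚ A := LinearMap.range
      (LinearMap.mulLeft ℚ n ∘ₗ LinearMap.mulRight ℚ e)
    have hV' : ∀ v ∈ V', ρ e v = v := by
      rintro _ ⟨v, rfl⟩
      rw [← Module.End.mul_apply, ← map_mul, he]
    have hW' : ∀ w ∈ W', w ∈ Ideal.span {e} := by
      rintro _ ⟨a, rfl⟩
      refine Ideal.mem_span_singleton'.2 ⟨n * a, ?_⟩
      simp [mul_assoc]
    -- The rational pairing gives the inequality of dimensions needed for a square matrix.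
    let D : V' →ₗ[ℚ] Module.Dual ℚ W' := LinearMap.mk₂ ℚ (fun v w => o (ρ w v))
      (by intros; simp) (by intros; simp) (by intros; simp) (by intros; simp)
    have hD : Function.Injective D := by
      rw [← LinearMap.ker_eq_bot, LinearMap.ker_eq_bot']
      intro v hv
      refine Subtype.ext (ho v fun a => ?_)
      have h1 := LinearMap.congr_fun hv ⟨n * (a * e), ⟨a, rfl⟩⟩
      have h2 : o (ρ (n * (a * e)) v) = 0 := h1
      rw [← mul_assoc, map_mul, Module.End.mul_apply, hV' v v.2] at h2
      exact h2
    have hdim : Module.finrank ℚ V' ≤ Module.finrank ℚ W' :=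
      (LinearMap.finrank_le_finrank_of_injective hD).trans Subspace.dual_finrank_eq.le
    by_contra hex
    let y : C ⊗[ℚ] V' := (ρ e).rangeRestrict.baseChange C x
    have hy : V'.subtype.baseChange C y = (ρ e).baseChange C x := by
      rw [← LinearMap.comp_apply, ← LinearMap.baseChange_comp]
      rfl
    have hy0 : y ≠ 0 := by
      intro h
      rw [h, map_zero] at hy
      exact hex hy.symm
    let β : W' →ₗ[ℚ] V' →ₗ[ℚ] C := LinearMap.mk₂ ℚ (fun w v => L (ρ w v))
      (by intros; simp) (by intros; simp) (by intros; simp) (by intros; simp)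
    have hβ : ∀ w, LinearMap.liftBaseChange C (β w) y = 0 := by
      rintro ⟨_, a, rfl⟩
      have h1 : L ∘ₗ ρ (n * (a * e)) = β ⟨_, a, rfl⟩ ∘ₗ (ρ e).rangeRestrict := by
        ext v
        change L (ρ (n * (a * e)) v) = L (ρ (n * (a * e)) (ρ e v))
        rw [← Module.End.mul_apply, ← map_mul, mul_assoc, mul_assoc, he]
      rw [← hx (a * e), h1, liftBaseChange_comp]
      rfl
    obtain ⟨w, v, hw, hv, hwv⟩ := exists_bilin_eq_zero β hdim
      (fun m M h => hM m M fun i j => (h i j).elim fun w ⟨v, h⟩ => ⟨_, h.symm⟩) hy0 hβ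
    have hzero : ρ w v = 0 := (map_eq_zero_iff L hL).1 hwv
    refine hw (Subtype.ext (eq_zero_of_isSimple ρ hsimple (hW' _ w.2) ?_ hzero))
    rw [hV' _ v.2]
    exact fun h => hv (Subtype.ext h)
  -- The annihilator of `x` is a left ideal containing all simple left ideals, hence contains `1`.
  let N : Submodule A A :=
    { carrier := {a | (ρ a).baseChange C x = 0}
      add_mem' := fun {a b} ha hb => by
        simp only [Set.mem_ofPred_eq, map_add, LinearMap.baseChange_add, LinearMap.add_apply] at *
        rw [ha, hb, add_zero]
      zero_mem' := by simp
      smul_mem' := fun a b hb => by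
        simp only [Set.mem_ofPred_eq, smul_eq_mul, map_mul, Module.End.mul_eq_comp,
          LinearMap.baseChange_comp, LinearMap.comp_apply] at *
        rw [hb, map_zero] }
  have hN : (⊤ : Submodule A A) ≤ N := by
    rw [← IsSemisimpleModule.sSup_simples_eq_top A A]
    refine sSup_le fun S hS => ?_
    obtain ⟨e, he, rfl⟩ := IsSemisimpleRing.ideal_eq_span_idempotent S
    exact (Ideal.span_singleton_le_iff_mem (I := N)).2 (key e he hS)
  have h1 : (ρ 1).baseChange C x = 0 := hN (Submodule.mem_top (x := (1 : A)))
  rw [map_one] at h1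
  simpa [Module.End.one_eq_id] using h1

end Semisimple

/-! ### The kernel of Iwasawa's logarithm -/

section LogKernel

variable (p : ℕ) [Fact p.Prime]

theorem iwasawaLog_pow {x : ℂ_[p]} (hx : x ≠ 0) (n : ℕ) :
    iwasawaLog p (x ^ n) = n * iwasawaLog p x := by
  induction n with
  | zero => simp [iwasawaLog_one]
  | succ n ih =>
    rw [pow_succ, iwasawaLog_mul p (pow_ne_zero n hx) hx, ih]
    push_cast
    ring

theorem iwasawaLog_prod {ι : Type*} (s : Finset ι) {f : ι → ℂ_[p]} (hf : ∀ i ∈ s, f i ≠ 0) :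
    iwasawaLog p (∏ i ∈ s, f i) = ∑ i ∈ s, iwasawaLog p (f i) := by
  classical
  induction s using Finset.induction_on with
  | empty => simp [iwasawaLog_one]
  | insert a s ha ih =>
    rw [Finset.prod_insert ha, Finset.sum_insert ha, iwasawaLog_mul p (hf a (by simp))
      (Finset.prod_ne_zero_iff.2 fun i hi => hf i (by simp [hi])),
      ih fun i hi => hf i (by simp [hi])]

/-- `log (1 + z)` has the leading term `z` for small `z`; in particular it vanishes only at `0`. -/
theorem norm_logSeries {z : ℂ_[p]} (hz : ‖z‖ < 1 / 4) : ‖logSeries p z - z‖ < ‖z‖ ∨ z = 0 := by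
  rcases eq_or_ne z 0 with h0 | h0
  · exact Or.inr h0
  refine Or.inl ?_
  have hpos : 0 < ‖z‖ := norm_pos_iff.2 h0
  have hterm : ∀ m : ℕ, ‖(-1) ^ m * z ^ (m + 1) / ((m : ℂ_[p]) + 1)‖ ≤
      ((m : ℝ) + 1) * ‖z‖ ^ (m + 1) := by
    intro m
    rw [div_eq_mul_inv, norm_mul, norm_mul, norm_pow, norm_neg, norm_one, one_pow, one_mul,
      norm_pow, mul_comm]
    exact mul_le_mul_of_nonneg_right (norm_inv_natCast_le p m) (by positivity)
  have hsum : Summable fun m : ℕ => ((m : ℝ) + 1) * ‖z‖ ^ (m + 1) := by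
    have h := summable_pow_mul_geometric_of_norm_lt_one (R := ℝ) 1 (r := ‖z‖)
      (by rw [norm_norm]; linarith)
    have := (summable_nat_add_iff 1).2 h
    simpa using this
  have hs := Summable.of_norm_bounded hsum hterm
  have hsplit : logSeries p z - z =
      ∑' m : ℕ, (-1) ^ (m + 1) * z ^ (m + 1 + 1) / (((m + 1 : ℕ) : ℂ_[p]) + 1) := by
    unfold logSeries
    rw [hs.tsum_eq_zero_add]
    simp
  rw [hsplit]
  -- Every remaining term has absolute value at most `2 ‖z‖ ^ 2`, which is less than `‖z‖`.
  have hb : ∀ m : ℕ, ((m : ℝ) + 2) * ‖z‖ ^ (m + 2) ≤ 2 * ‖z‖ ^ 2 := by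
    intro m
    induction m with
    | zero => simp
    | succ m ih =>
      refine le_trans ?_ ih
      rw [show m + 1 + 2 = m + 2 + 1 by ring, pow_succ]
      push_cast
      have : 0 ≤ ‖z‖ ^ (m + 2) := by positivity
      have h3 : ((m : ℝ) + 1 + 2) * ‖z‖ ≤ m + 2 := by
        nlinarith [(Nat.cast_nonneg m : (0 : ℝ) ≤ m)]
      nlinarith [mul_le_mul_of_nonneg_left h3 this]
  refine lt_of_le_of_lt (IsUltrametricDist.norm_tsum_le_of_forall_le_of_nonneg
    (C := 2 * ‖z‖ ^ 2) (by positivity) fun m => ?_) ?_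
  · refine (hterm (m + 1)).trans ?_
    refine le_trans (le_of_eq ?_) (hb m)
    push_cast
    ring
  · nlinarith

/-- The kernel of Iwasawa's logarithm: roots of unity times rational powers of `p`. -/
theorem exists_pow_eq_zpow_of_iwasawaLog_eq_zero {x : ℂ_[p]} (hx : x ≠ 0)
    (h : iwasawaLog p x = 0) : ∃ (n : ℕ) (k : ℤ), n ≠ 0 ∧ x ^ n = (p : ℂ_[p]) ^ k := by
  obtain ⟨⟨n, k⟩, hn, hz⟩ := exists_oneUnit p hx
  dsimp only at hn hz
  rw [iwasawaLog_eq p hn hz, div_eq_zero_iff] at h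
  have hlog := h.resolve_right (by exact_mod_cast hn.ne')
  set a := x ^ n * (p : ℂ_[p]) ^ (-k) with ha
  have hlim := tendsto_logSeries p hz
  rw [add_sub_cancel, hlog] at hlim
  have hlim2 : Tendsto (fun m : ℕ => a ^ p ^ m - 1) atTop (𝓝 0) := by
    have := hlim.mul (tendsto_p_pow p)
    rw [zero_mul] at this
    refine this.congr fun m => ?_
    rw [div_mul_cancel₀]
    exact_mod_cast pow_ne_zero m (Fact.out : p.Prime).ne_zero
  -- `a ^ p ^ m` tends to `1` and has logarithm `0`, so it is eventually equal to `1`.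
  obtain ⟨m, hm⟩ := (hlim2.norm.eventually_lt_const (show ‖(0 : ℂ_[p])‖ < 1 / 4 by simp)).exists
  have hone : a ^ p ^ m = 1 := by
    rcases norm_logSeries p hm with h1 | h1
    · rw [logSeries_pow p hz, hlog, mul_zero, zero_sub, norm_neg] at h1
      exact absurd h1 (lt_irrefl _)
    · exact sub_eq_zero.1 h1
  refine ⟨n * p ^ m, k * (p ^ m : ℕ), by
    exact mul_ne_zero hn.ne' (pow_ne_zero m (Fact.out : p.Prime).ne_zero), ?_⟩
  rw [ha, mul_pow, zpow_neg, inv_pow, mul_inv_eq_one₀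
    (pow_ne_zero _ (zpow_ne_zero _ (p_ne_zero p)))] at hone
  rw [pow_mul, hone, zpow_mul, zpow_natCast]

end LogKernel

/-! ### Logarithms of algebraic numbers -/

section LogAlg

variable (p : ℕ) [Fact p.Prime]

theorem iwasawaLog_mem_logAlg {x : ℂ_[p]} (hx : x ≠ 0) (halg : IsAlgebraic ℚ x) :
    iwasawaLog p x ∈ logAlg p := ⟨x, hx, halg, rfl⟩

/-- `𝓛_p` is stable under division by natural numbers, since `ℚ̄` is algebraically closed. -/
theorem inv_natCast_mul_mem_logAlg {l : ℂ_[p]} (hl : l ∈ logAlg p) {n : ℕ} (hn : n ≠ 0) :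
    (n : ℂ_[p])⁻¹ * l ∈ logAlg p := by
  obtain ⟨x, hx, halg, rfl⟩ := hl
  obtain ⟨y, hy⟩ := IsAlgClosed.exists_pow_nat_eq x (Nat.pos_of_ne_zero hn)
  have hy0 : y ≠ 0 := by
    rintro rfl
    rw [zero_pow hn] at hy
    exact hx hy.symm
  refine ⟨y, hy0, IsAlgebraic.of_pow (Nat.pos_of_ne_zero hn) (hy ▸ halg), ?_⟩
  rw [← hy, iwasawaLog_pow p hy0, inv_mul_cancel_left₀ (by exact_mod_cast hn)]

end LogAlg

/-! ### Embeddings of local fields are isometries -/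

section Isometry

variable (p : ℕ) [Fact p.Prime]

/-- The absolute value of `y ∈ ℂ_[p]` algebraic over `ℚ_[p]` depends only on its minimal polynomial:
such a `y` lies in the algebraic closure of `ℚ_[p]`, which carries the spectral norm. -/
theorem norm_eq_spectralNorm {y : ℂ_[p]} (hy : IsAlgebraic ℚ_[p] y) :
    ‖y‖ = spectralValue (minpoly ℚ_[p] y) := by
  obtain ⟨z, rfl⟩ : ∃ z : PadicAlgCl p, algebraMap (PadicAlgCl p) ℂ_[p] z = y := by
    refine (IsAlgClosed.splits ((minpoly ℚ_[p] y).map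
      (algebraMap ℚ_[p] (PadicAlgCl p)))).mem_range_of_isRoot
      (Polynomial.map_ne_zero (minpoly.ne_zero hy.isIntegral)) ?_
    rw [Polynomial.map_map, ← IsScalarTower.algebraMap_eq, Polynomial.IsRoot,
      Polynomial.eval_map_algebraMap, minpoly.aeval]
  rw [← PadicComplex.coe_eq, PadicComplex.norm_extends, ← PadicAlgCl.spectralNorm_eq, spectralNorm,
    PadicComplex.coe_eq, minpoly.algebraMap_eq (algebraMap (PadicAlgCl p) ℂ_[p]).injective]

/-- Embeddings of algebraic extensions of `ℚ_[p]` in `ℂ_[p]` are isometries. -/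
theorem norm_algHom_apply (K : IntermediateField ℚ_[p] ℂ_[p]) [Algebra.IsAlgebraic ℚ_[p] K]
    (σ : K →ₐ[ℚ_[p]] ℂ_[p]) (y : K) : ‖σ y‖ = ‖(y : ℂ_[p])‖ := by
  have hy : IsAlgebraic ℚ_[p] y := Algebra.IsAlgebraic.isAlgebraic y
  have h1 := norm_eq_spectralNorm p (hy.algHom σ)
  have h2 := norm_eq_spectralNorm p (hy.algHom K.val)
  rw [minpoly.algHom_eq _ (RingHom.injective _)] at h1 h2
  exact h1.trans h2.symm

end Isometry

/-! ### Local norms -/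

section LocalField

theorem map_isAlgebraic {F C : Type*} [Field F] [NumberField F] [Field C] [CharZero C]
    (ι : F →+* C) (x : F) : IsAlgebraic ℚ (ι x) :=
  (Algebra.IsAlgebraic.isAlgebraic (R := ℚ) x).algHom ι.toRatAlgHom

variable (p : ℕ) [Fact p.Prime] {F : Type*} [Field F] [NumberField F]

instance finiteDimensional_localField (ι : F →+* ℂ_[p]) :
    FiniteDimensional ℚ_[p] (localField p ι) := by
  let b := Module.finBasis ℚ F
  have hle : localField p ι ≤ IntermediateField.adjoin ℚ_[p] (Set.range (ι ∘ b)) := by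
    refine IntermediateField.adjoin_le_iff.2 ?_
    rintro _ ⟨x, rfl⟩
    rw [← b.sum_repr x, map_sum]
    refine sum_mem fun i _ => ?_
    rw [Rat.smul_def, map_mul, map_ratCast]
    exact mul_mem (SubfieldClass.ratCast_mem _ _) (IntermediateField.subset_adjoin _ _ ⟨i, rfl⟩)
  have hfin : FiniteDimensional ℚ_[p] (IntermediateField.adjoin ℚ_[p] (Set.range (ι ∘ b))) := by
    have := (Set.finite_range (ι ∘ b)).to_subtype
    refine IntermediateField.finiteDimensional_adjoin ?_
    rintro _ ⟨i, rfl⟩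
    exact ((map_isAlgebraic ι (b i)).extendScalars (algebraMap ℚ ℚ_[p]).injective).isIntegral
  exact FiniteDimensional.of_injective (IntermediateField.inclusion hle).toLinearMap
    (IntermediateField.inclusion hle).injective

/-- The local norm is the product of the conjugates of `ι x` over `ℚ_[p]`. -/
theorem algebraMap_localNorm (ι : F →+* ℂ_[p]) (x : F) :
    algebraMap ℚ_[p] ℂ_[p] (localNorm p ι x) = ∏ σ : localField p ι →ₐ[ℚ_[p]] ℂ_[p],
      σ ⟨ι x, IntermediateField.subset_adjoin ℚ_[p] _ (Set.mem_range_self x)⟩ :=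
  Algebra.norm_eq_prod_embeddings _ _ _

end LocalField

/-! ### Automorphisms and valuations -/

section PrimeComap

open IsDedekindDomain HeightOneSpectrum

variable {F : Type*} [Field F]

/-- The preimage `σ⁻¹(P)` of a prime `P` under an automorphism `σ` of the field. -/
def primeComap (σ : F ≃+* F) (P : HeightOneSpectrum (𝓞 F)) : HeightOneSpectrum (𝓞 F) :=
  P.comap (NumberField.RingOfIntegers.mapRingEquiv σ : 𝓞 F →+* 𝓞 F)
    (NumberField.RingOfIntegers.mapRingEquiv σ).surjective

theorem mem_primeComap (σ : F ≃+* F) (P : HeightOneSpectrum (𝓞 F)) (x : 𝓞 F) :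
    x ∈ (primeComap σ P).asIdeal ↔ NumberField.RingOfIntegers.mapRingEquiv σ x ∈ P.asIdeal :=
  Iff.rfl

theorem mem_primeComap_pow (σ : F ≃+* F) (P : HeightOneSpectrum (𝓞 F)) (n : ℕ) (x : 𝓞 F) :
    x ∈ (primeComap σ P).asIdeal ^ n ↔
      NumberField.RingOfIntegers.mapRingEquiv σ x ∈ P.asIdeal ^ n := by
  set e := NumberField.RingOfIntegers.mapRingEquiv σ
  have h : (primeComap σ P).asIdeal = P.asIdeal.map e.symm := (Ideal.map_symm e).symm
  rw [h, ← Ideal.map_pow, Ideal.map_symm]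
  rfl


variable [NumberField F]

theorem intValuation_primeComap (σ : F ≃+* F) (P : HeightOneSpectrum (𝓞 F)) (x : 𝓞 F) :
    (primeComap σ P).intValuation x =
      P.intValuation (NumberField.RingOfIntegers.mapRingEquiv σ x) := by
  rcases eq_or_ne x 0 with rfl | hx
  · simp
  have hx' : NumberField.RingOfIntegers.mapRingEquiv σ x ≠ 0 := by simpa using hx
  apply le_antisymm
  · rw [intValuation_if_neg P hx', intValuation_le_pow_iff_mem, mem_primeComap_pow,
      ← intValuation_le_pow_iff_mem, intValuation_if_neg P hx']
  · rw [intValuation_if_neg _ hx, intValuation_le_pow_iff_mem, ← mem_primeComap_pow,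
      ← intValuation_le_pow_iff_mem, intValuation_if_neg _ hx]

theorem valuation_primeComap (σ : F ≃+* F) (P : HeightOneSpectrum (𝓞 F)) (x : F) :
    (primeComap σ P).valuation F x = P.valuation F (σ x) := by
  obtain ⟨a, b, hb, rfl⟩ := IsFractionRing.div_surjective (A := 𝓞 F) x
  have h : ∀ a : 𝓞 F, σ (algebraMap (𝓞 F) F a) =
    algebraMap (𝓞 F) F (NumberField.RingOfIntegers.mapRingEquiv σ a) := fun a => rfl
  rw [map_div₀, map_div₀, map_div₀, h, h]
  simp only [valuation_of_algebraMap, intValuation_primeComap]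

end PrimeComap

/-! ### Valuations of `p`-units -/

section Ord

open IsDedekindDomain HeightOneSpectrum

variable (p : ℕ) {F : Type*} [Field F] [NumberField F]

/-- The additive `P`-adic valuation of `p`-units. -/
def ordAt (P : HeightOneSpectrum (𝓞 F)) : Additive (pUnits p F) →+ ℚ where
  toFun u := -(WithZero.log (P.valuation F ((u.toMul : Fˣ) : F)) : ℤ)
  map_zero' := by simp
  map_add' u v := by
    rw [toMul_add, Subgroup.coe_mul, Units.val_mul, map_mul, WithZero.log_mul, Int.cast_add, neg_add]
    · exact (map_ne_zero _).2 (Units.ne_zero _)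
    · exact (map_ne_zero _).2 (Units.ne_zero _)

theorem ordAt_eq_zero_iff (P : HeightOneSpectrum (𝓞 F)) (u : Additive (pUnits p F)) :
    ordAt p P u = 0 ↔ P.valuation F ((u.toMul : Fˣ) : F) = 1 := by
  have h0 : P.valuation F ((u.toMul : Fˣ) : F) ≠ 0 := (map_ne_zero _).2 (Units.ne_zero _)
  change -((WithZero.log (P.valuation F ((u.toMul : Fˣ) : F)) : ℤ) : ℚ) = 0 ↔ _
  rw [neg_eq_zero, Int.cast_eq_zero]
  refine ⟨fun h => ?_, fun h => by rw [h, WithZero.log_one]⟩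
  rw [← WithZero.exp_log h0, h, WithZero.exp_zero]

theorem valuation_le_one_of_mem_adjoin {P : HeightOneSpectrum (𝓞 F)} (hP : (p : 𝓞 F) ∉ P.asIdeal)
    {x : F} (hx : x ∈ Algebra.adjoin (𝓞 F) {((p : F))⁻¹}) : P.valuation F x ≤ 1 := by
  have hp : P.valuation F (p : F) = 1 := by
    have := (P.valuation_eq_one_iff_notMem (K := F)).2 hP
    rwa [map_natCast] at this
  induction hx using Algebra.adjoin_induction with
  | mem x hx =>
    rw [Set.mem_singleton_iff] at hx
    rw [hx, map_inv₀, hp, inv_one]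
  | algebraMap r => exact P.valuation_le_one r
  | add x y _ _ hx hy => exact (P.valuation F).map_add_le hx hy
  | mul x y _ _ hx hy =>
    rw [map_mul]
    exact mul_le_one' hx hy

theorem valuation_eq_one_of_notMem {P : HeightOneSpectrum (𝓞 F)} (hP : (p : 𝓞 F) ∉ P.asIdeal)
    (u : pUnits p F) : P.valuation F ((u : Fˣ) : F) = 1 := by
  have hu := (Submonoid.mem_units_iff _ _).1 u.2
  refine le_antisymm (valuation_le_one_of_mem_adjoin p hP hu.1) ?_
  have h := valuation_le_one_of_mem_adjoin p hP hu.2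
  rw [Units.val_inv_eq_inv_val, map_inv₀] at h
  exact (inv_le_one₀ (zero_lt_iff.2 ((map_ne_zero _).2 (Units.ne_zero _)))).1 h

/-- A `p`-unit which is a unit at the primes above `p` is integral. -/
theorem isIntegral_of_valuation_eq_one (u : pUnits p F)
    (h : ∀ P : HeightOneSpectrum (𝓞 F), (p : 𝓞 F) ∈ P.asIdeal →
      P.valuation F ((u : Fˣ) : F) = 1) : IsIntegral ℤ ((u : Fˣ) : F) := by
  obtain ⟨y, hy⟩ := mem_integers_of_valuation_le_one (R := 𝓞 F) F ((u : Fˣ) : F) fun P => by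
    by_cases hP : (p : 𝓞 F) ∈ P.asIdeal
    · exact (h P hP).le
    · exact (valuation_eq_one_of_notMem p hP u).le
  rw [← hy]
  exact y.isIntegral_coe

end Ord

/-! ### Functoriality of rational `p`-units -/

section Functoriality

variable (p : ℕ) {F E K : Type*} [Field F] [Field E] [Field K]

theorem map_mem_adjoin_of_ringHom (j : F →+* E) {x : F}
    (hx : x ∈ Algebra.adjoin (𝓞 F) {((p : F))⁻¹}) :
    j x ∈ Algebra.adjoin (𝓞 E) {((p : E))⁻¹} := by
  induction hx using Algebra.adjoin_induction with
  | mem x hx =>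
    rw [Set.mem_singleton_iff] at hx
    rw [hx, map_inv₀, map_natCast]
    exact Algebra.subset_adjoin rfl
  | algebraMap r =>
    exact Subalgebra.algebraMap_mem (Algebra.adjoin (𝓞 E) {((p : E))⁻¹})
      (NumberField.RingOfIntegers.mapRingHom j r)
  | add x y _ _ hx hy => rw [map_add]; exact add_mem hx hy
  | mul x y _ _ hx hy => rw [map_mul]; exact mul_mem hx hy

/-- The homomorphism of groups of `p`-units induced by a field embedding, written additively. -/
def pUnitsHom (j : F →+* E) : Additive (pUnits p F) →+ Additive (pUnits p E) :=
  MonoidHom.toAdditive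
    (((Units.map (j : F →* E)).comp (pUnits p F).subtype).codRestrict (pUnits p E) fun u => by
      have hu := (Submonoid.mem_units_iff _ _).1 u.2
      refine (Submonoid.mem_units_iff _ _).2 ⟨map_mem_adjoin_of_ringHom p j hu.1, ?_⟩
      rw [← map_inv]
      exact map_mem_adjoin_of_ringHom p j hu.2)

@[simp]
theorem coe_pUnitsHom (j : F →+* E) (u : Additive (pUnits p F)) :
    (((pUnitsHom p j u).toMul : Eˣ) : E) = j ((u.toMul : Fˣ) : F) := rfl

theorem pUnits_ext {u v : Additive (pUnits p F)}
    (h : ((u.toMul : Fˣ) : F) = ((v.toMul : Fˣ) : F)) : u = v :=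
  Subtype.ext (Units.ext h)

theorem pUnitsHom_injective (j : F →+* E) : Function.Injective (pUnitsHom p j) := fun u v h =>
  pUnits_ext p (j.injective (by rw [← coe_pUnitsHom, h, coe_pUnitsHom]))

/-- The map `U_F → U_E` of rational `p`-units induced by a field embedding `F → E`. -/
def pUnitsQMap (j : F →+* E) : PUnitsQ p F →ₗ[ℚ] PUnitsQ p E :=
  LinearMap.baseChange ℚ (pUnitsHom p j).toIntLinearMap

@[simp]
theorem pUnitsQMap_tmul (j : F →+* E) (q : ℚ) (u : Additive (pUnits p F)) :
    pUnitsQMap p j (q ⊗ₜ u) = q ⊗ₜ pUnitsHom p j u := rfl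

theorem pUnitsQMap_comp (j : F →+* E) (k : E →+* K) (v : PUnitsQ p F) :
    pUnitsQMap p (k.comp j) v = pUnitsQMap p k (pUnitsQMap p j v) := by
  rw [pUnitsQMap, pUnitsQMap, pUnitsQMap, ← LinearMap.comp_apply, ← LinearMap.baseChange_comp]
  rfl

theorem pUnitsQMap_id (v : PUnitsQ p F) : pUnitsQMap p (RingHom.id F) v = v := by
  have h : (pUnitsHom p (RingHom.id F)).toIntLinearMap = LinearMap.id := rfl
  rw [pUnitsQMap, h, LinearMap.baseChange_id, LinearMap.id_apply]

theorem pUnitsQMap_injective (j : F →+* E) : Function.Injective (pUnitsQMap p j) :=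
  Module.Flat.lTensor_preserves_injective_linearMap _ (pUnitsHom_injective p j)

/-- The linear functional on rational `p`-units defined by a homomorphism on `p`-units. -/
def evalQ {C : Type*} [Field C] [Algebra ℚ C] (f : Additive (pUnits p F) →+ C) :
    PUnitsQ p F →ₗ[ℚ] C :=
  LinearMap.liftBaseChange ℚ f.toIntLinearMap

@[simp]
theorem evalQ_tmul {C : Type*} [Field C] [Algebra ℚ C] (f : Additive (pUnits p F) →+ C) (q : ℚ)
    (u : Additive (pUnits p F)) : evalQ p f (q ⊗ₜ u) = q • f u := rfl

theorem evalQ_pUnitsQMap {C : Type*} [Field C] [Algebra ℚ C] (j : F →+* E)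
    (f : Additive (pUnits p E) →+ C) (v : PUnitsQ p F) :
    evalQ p f (pUnitsQMap p j v) = evalQ p (f.comp (pUnitsHom p j)) v := by
  induction v using TensorProduct.induction_on with
  | zero => simp
  | tmul q u => simp
  | add v w hv hw => rw [map_add, map_add, map_add, hv, hw]

end Functoriality

/-! ### The minus part -/

section MinusPart

open NumberField

variable (p : ℕ) {F E : Type*} [Field F] [NumberField F] [IsCMField F]
  [Field E] [NumberField E] [IsCMField E]

/-- Complex conjugation commutes with every embedding of CM fields. -/
theorem map_complexConj (j : F →+* E) (x : F) :
    j (IsCMField.complexConj F x) = IsCMField.complexConj E (j x) := by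
  let φ : E →+* ℂ := Classical.choice inferInstance
  apply φ.injective
  rw [IsCMField.complexEmbedding_complexConj]
  exact IsCMField.complexEmbedding_complexConj F (φ.comp j) x

theorem mem_minusPart_iff {v : PUnitsQ p F} : v ∈ minusPart p F ↔
    pUnitsQMap p (IsCMField.complexConj F : F →+* F) v + v = 0 := Iff.rfl

/-- The map `U_F⁻ → U_E⁻` induced by an embedding `F → E` of CM fields. -/
def minusMap (j : F →+* E) : minusPart p F →ₗ[ℚ] minusPart p E :=
  (pUnitsQMap p j).restrict fun v hv => by
    rw [mem_minusPart_iff] at hv ⊢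
    have h : (IsCMField.complexConj E : E →+* E).comp j =
        j.comp (IsCMField.complexConj F : F →+* F) :=
      RingHom.ext fun x => (map_complexConj j x).symm
    rw [← pUnitsQMap_comp, h, pUnitsQMap_comp, ← map_add, hv, map_zero]

@[simp]
theorem coe_minusMap (j : F →+* E) (v : minusPart p F) :
    (minusMap p j v : PUnitsQ p E) = pUnitsQMap p j v := rfl

theorem minusMap_injective (j : F →+* E) : Function.Injective (minusMap p j) := fun _ _ h =>
  Subtype.ext (pUnitsQMap_injective p j (congrArg Subtype.val h))

/-- The representation of `Gal(F/ℚ)` on `U⁻`. -/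
def minusRep (F : Type*) [Field F] [NumberField F] [IsCMField F] :
    (F ≃ₐ[ℚ] F) →* Module.End ℚ (minusPart p F) where
  toFun σ := minusMap p (σ : F →+* F)
  map_one' := LinearMap.ext fun v => Subtype.ext (pUnitsQMap_id p (v : PUnitsQ p F))
  map_mul' σ τ := LinearMap.ext fun v =>
    Subtype.ext (pUnitsQMap_comp p (τ : F →+* F) (σ : F →+* F) (v : PUnitsQ p F))

/-- Up to a multiple, an element of `U⁻` is a `p`-unit `u` with `u * c u = 1`. -/
theorem exists_nsmul_eq_of_mem_minusPart (v : minusPart p F) :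
    ∃ m : ℕ, m ≠ 0 ∧ ∃ u : Additive (pUnits p F), (m • v : PUnitsQ p F) = 1 ⊗ₜ u ∧
      IsCMField.complexConj F ((u.toMul : Fˣ) : F) * ((u.toMul : Fˣ) : F) = 1 := by
  obtain ⟨m, hm, u, hu⟩ := exists_nsmul_eq_one_tmul (v : PUnitsQ p F)
  have hv := (mem_minusPart_iff p).1 v.2
  have h : (1 : ℚ) ⊗ₜ[ℤ] (pUnitsHom p (IsCMField.complexConj F : F →+* F) u + u) = 0 := by
    rw [TensorProduct.tmul_add, ← pUnitsQMap_tmul, ← hu, map_nsmul, ← smul_add, hv, smul_zero]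
  obtain ⟨k, hk, hku⟩ := one_tmul_eq_zero h
  refine ⟨k * m, mul_ne_zero hk hm, k • u, ?_, ?_⟩
  · rw [mul_smul, hu, TensorProduct.tmul_smul]
  · rw [nsmul_add, ← map_nsmul] at hku
    have := congrArg (fun u : Additive (pUnits p F) => ((u.toMul : Fˣ) : F)) hku
    exact this

theorem eq_zero_of_torsion {v : minusPart p F} {m n : ℕ} (hm : m ≠ 0) (hn : n ≠ 0)
    {u : Additive (pUnits p F)} (hu : (m • v : PUnitsQ p F) = 1 ⊗ₜ u)
    (h : ((u.toMul : Fˣ) : F) ^ n = 1) : v = 0 := by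
  have h1 : n • u = 0 := pUnits_ext p h
  have h2 : n • m • (v : PUnitsQ p F) = 0 := by
    rw [hu, ← TensorProduct.tmul_smul, h1, TensorProduct.tmul_zero]
  refine Subtype.ext ?_
  rw [← Nat.cast_smul_eq_nsmul ℚ, ← Nat.cast_smul_eq_nsmul ℚ, smul_eq_zero, smul_eq_zero] at h2
  exact (h2.resolve_left (by exact_mod_cast hn)).resolve_left (by exact_mod_cast hm)

/-- `U⁻` is detected by the valuations above `p`: units `u` of a CM field with `u * c u = 1` are
roots of unity, by Kronecker's theorem. -/
theorem eq_zero_of_ordAt_eq_zero {v : minusPart p F}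
    (h : ∀ P : IsDedekindDomain.HeightOneSpectrum (𝓞 F), (p : 𝓞 F) ∈ P.asIdeal →
      evalQ p (ordAt p P) v = 0) : v = 0 := by
  obtain ⟨m, hm, u, hu, hcu⟩ := exists_nsmul_eq_of_mem_minusPart p v
  have hint : IsIntegral ℤ ((u.toMul : Fˣ) : F) := by
    refine isIntegral_of_valuation_eq_one p u.toMul fun P hP => ?_
    rw [← ordAt_eq_zero_iff]
    have h1 := congrArg (evalQ p (ordAt p P)) hu
    rw [map_nsmul, h P hP, smul_zero, evalQ_tmul, one_smul] at h1
    exact h1.symm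
  obtain ⟨n, hn, hun⟩ := Embeddings.pow_eq_one_of_norm_eq_one F ℂ hint fun φ => by
    have h1 := congrArg φ hcu
    rw [map_mul, IsCMField.complexEmbedding_complexConj, map_one, mul_comm,
      Complex.mul_conj] at h1
    have h2 : Complex.normSq (φ ((u.toMul : Fˣ) : F)) = 1 := by exact_mod_cast h1
    rw [Complex.normSq_eq_norm_sq] at h2
    exact (pow_eq_one_iff_of_nonneg (norm_nonneg _) two_ne_zero).1 h2
  exact eq_zero_of_torsion p hm hn.ne' hu hun

variable [Fact p.Prime]

/-- The homomorphism `u ↦ log_p (ι u)` on `p`-units. -/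
def logEmb {F : Type*} [Field F] (ι : F →+* ℂ_[p]) : Additive (pUnits p F) →+ ℂ_[p] where
  toFun u := iwasawaLog p (ι ((u.toMul : Fˣ) : F))
  map_zero' := by simp [iwasawaLog_one]
  map_add' u v := by
    rw [toMul_add, Subgroup.coe_mul, Units.val_mul, map_mul, iwasawaLog_mul]
    · exact (map_ne_zero _).2 (Units.ne_zero _)
    · exact (map_ne_zero _).2 (Units.ne_zero _)

/-- `log_p ∘ ι` is injective on `U⁻`: a power of `u` is a power of `p`, hence fixed by complex
conjugation, which also inverts it. -/
theorem evalQ_logEmb_injective (ι : F →+* ℂ_[p]) :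
    Function.Injective (evalQ p (logEmb p ι) ∘ₗ (minusPart p F).subtype) := by
  rw [← LinearMap.ker_eq_bot, LinearMap.ker_eq_bot']
  intro v hv
  obtain ⟨m, hm, u, hu, hcu⟩ := exists_nsmul_eq_of_mem_minusPart p v
  have h1 := congrArg (evalQ p (logEmb p ι)) hu
  have hv' : evalQ p (logEmb p ι) v = 0 := hv
  rw [map_nsmul, hv', smul_zero, evalQ_tmul, one_smul] at h1
  obtain ⟨n, k, hn, hnk⟩ := exists_pow_eq_zpow_of_iwasawaLog_eq_zero p
    ((map_ne_zero ι).2 (Units.ne_zero u.toMul.1)) h1.symm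
  have h2 : ((u.toMul : Fˣ) : F) ^ n = (p : F) ^ k := by
    apply ι.injective
    rw [map_pow, hnk, map_zpow₀, map_natCast]
  have h3 := congrArg (· ^ n) hcu
  simp only [mul_pow, one_pow, ← map_pow, h2, map_zpow₀, map_natCast] at h3
  refine eq_zero_of_torsion p hm (mul_ne_zero two_ne_zero hn) hu ?_
  rw [mul_comm, pow_mul, h2, sq, h3]

theorem evalQ_logEmb_mem_logAlg (ι : F →+* ℂ_[p]) (v : minusPart p F) :
    evalQ p (logEmb p ι) v ∈ logAlg p := by
  obtain ⟨m, hm, u, hu, -⟩ := exists_nsmul_eq_of_mem_minusPart p v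
  have h1 := congrArg (evalQ p (logEmb p ι)) hu
  rw [map_nsmul, evalQ_tmul, one_smul, nsmul_eq_mul] at h1
  have h2 : evalQ p (logEmb p ι) v = (m : ℂ_[p])⁻¹ * logEmb p ι u := by
    rw [← h1, inv_mul_cancel_left₀ (by exact_mod_cast hm)]
  rw [h2]
  exact inv_natCast_mul_mem_logAlg p (iwasawaLog_mem_logAlg p
    ((map_ne_zero ι).2 (Units.ne_zero u.toMul.1)) (map_isAlgebraic ι _)) hm

end MinusPart

/-! ### The prime determined by an embedding -/

section PrimeOfEmbedding

variable (p : ℕ) [Fact p.Prime] {F : Type*} [Field F]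

theorem mem_primesOver_span_iff {R : Type*} [CommRing R] {I : Ideal R} (hI : I.IsPrime) :
    I ∈ (Ideal.span {(p : ℤ)}).primesOver R ↔ (p : R) ∈ I := by
  have hmax : (Ideal.span {(p : ℤ)}).IsMaximal := Int.ideal_span_isMaximal_of_prime p
  constructor
  · rintro ⟨-, h⟩
    have h1 : (p : ℤ) ∈ (Ideal.span {(p : ℤ)}) := Ideal.mem_span_singleton_self _
    rw [h.over, Ideal.under_def, Ideal.mem_comap] at h1
    simpa using h1
  · intro h
    refine ⟨hI, ⟨hmax.eq_of_le (Ideal.IsPrime.ne_top (hI.under ℤ)) ?_⟩⟩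
    rw [Ideal.span_singleton_le_iff_mem, Ideal.under_def, Ideal.mem_comap]
    simpa using h

/-- Algebraic integers lie in the valuation ring of `ℂ_[p]`, which is integrally closed. -/
theorem norm_map_integer_le_one (ι : F →+* ℂ_[p]) (x : 𝓞 F) : ‖ι x‖ ≤ 1 := by
  obtain ⟨P, hP, hx⟩ := x.isIntegral_coe
  have hint : IsIntegral 𝓞_ℂ_[p] (ι x) := by
    refine ⟨P.map (Int.castRingHom _), hP.map _, ?_⟩
    rw [Polynomial.eval₂_map, ← map_zero ι, ← hx, Polynomial.hom_eval₂]
    congr 1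
    exact RingHom.ext_int _ _
  have h := (PadicComplexInt.integers p).mem_of_integral hint
  exact (PadicComplex.norm_eq_norm p _).trans_le
    (Valued.toNormedField.norm_le_one_iff.2 ((Valuation.mem_integer_iff _ _).1 h))

variable [NumberField F]

/-- The prime of `F` above `p` determined by an embedding `ι : F → ℂ_[p]`: the integers `x`
with `‖ι x‖ < 1`. -/
def primeOf (ι : F →+* ℂ_[p]) : IsDedekindDomain.HeightOneSpectrum (𝓞 F) where
  asIdeal :=
    { carrier := {x | ‖ι x‖ < 1}
      add_mem' := fun {x y} hx hy => by
        change ‖ι (algebraMap (𝓞 F) F (x + y))‖ < 1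
        rw [map_add, map_add]
        exact norm_add_lt p hx hy
      zero_mem' := by simp
      smul_mem' := fun c x hx => by
        change ‖ι (algebraMap (𝓞 F) F (c * x))‖ < 1
        rw [map_mul, map_mul, norm_mul]
        exact mul_lt_one_of_nonneg_of_lt_one_right
          (norm_map_integer_le_one p ι c) (norm_nonneg _) hx }
  isPrime := by
    refine Ideal.isPrime_iff.2 ⟨fun h => ?_, fun {x y} hxy => ?_⟩
    · have h1 : ‖ι ((1 : 𝓞 F) : F)‖ < 1 := (Ideal.eq_top_iff_one _).1 h
      simp at h1
    · by_contra! h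
      have hx : 1 ≤ ‖ι (x : F)‖ := not_lt.1 h.1
      have hy : 1 ≤ ‖ι (y : F)‖ := not_lt.1 h.2
      have hxy' : ‖ι (algebraMap (𝓞 F) F (x * y))‖ < 1 := hxy
      rw [map_mul, map_mul, norm_mul] at hxy'
      exact absurd hxy' (not_lt.2 (one_le_mul_of_one_le_of_one_le hx hy))
  ne_bot := by
    intro h
    have hp : (p : 𝓞 F) ∈ (⊥ : Ideal (𝓞 F)) := by
      rw [← h]
      change ‖ι ((p : 𝓞 F) : F)‖ < 1
      simpa using norm_p_lt_one p
    rw [Ideal.mem_bot] at hp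
    exact (Fact.out : p.Prime).ne_zero (by exact_mod_cast hp)

theorem mem_primeOf (ι : F →+* ℂ_[p]) (x : 𝓞 F) : x ∈ (primeOf p ι).asIdeal ↔ ‖ι x‖ < 1 :=
  Iff.rfl

theorem natCast_mem_primeOf (ι : F →+* ℂ_[p]) : (p : 𝓞 F) ∈ (primeOf p ι).asIdeal := by
  rw [mem_primeOf]
  simpa using norm_p_lt_one p

end PrimeOfEmbedding

/-! ### Injectivity for Galois CM fields -/

section Galois

variable (p : ℕ) {F : Type*} [Field F] [NumberField F]

/-- Embeddings of a Galois field differ by elements of the Galois group. -/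
theorem exists_algEquiv_of_isGalois [IsGalois ℚ F] {C : Type*} [Field C] [CharZero C]
    (ι κ : F →+* C) : ∃ g : F ≃ₐ[ℚ] F, ∀ x, κ x = ι (g x) := by
  let : Algebra F C := ι.toAlgebra
  let g := Normal.algHomEquivAut ℚ C F κ.toRatAlgHom
  refine ⟨g, fun x => ?_⟩
  have h := (Normal.algHomEquivAut ℚ C F).symm_apply_apply κ.toRatAlgHom
  exact (DFunLike.congr_fun h x).symm

theorem ordAt_pUnitsHom (P : IsDedekindDomain.HeightOneSpectrum (𝓞 F)) (g : F ≃+* F)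
    (u : Additive (pUnits p F)) :
    ordAt p P (pUnitsHom p (g : F →+* F) u) = ordAt p (primeComap g P) u := by
  change -((WithZero.log (P.valuation F (g ((u.toMul : Fˣ) : F))) : ℤ) : ℚ) =
    -((WithZero.log ((primeComap g P).valuation F ((u.toMul : Fˣ) : F)) : ℤ) : ℚ)
  rw [valuation_primeComap]

theorem evalQ_ordAt_pUnitsQMap (P : IsDedekindDomain.HeightOneSpectrum (𝓞 F)) (g : F ≃+* F)
    (v : PUnitsQ p F) : evalQ p (ordAt p P) (pUnitsQMap p (g : F →+* F) v) =
      evalQ p (ordAt p (primeComap g P)) v := by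
  rw [evalQ_pUnitsQMap]
  congr 2
  exact AddMonoidHom.ext fun u => ordAt_pUnitsHom p P g u

variable [Fact p.Prime]

/-- The Galois group acts transitively on the primes above `p`. -/
theorem exists_primeComap_eq [IsGalois ℚ F] {P Q : IsDedekindDomain.HeightOneSpectrum (𝓞 F)}
    (hP : (p : 𝓞 F) ∈ P.asIdeal) (hQ : (p : 𝓞 F) ∈ Q.asIdeal) :
    ∃ g : F ≃ₐ[ℚ] F, primeComap g.toRingEquiv P = Q := by
  obtain ⟨s, hs⟩ := Ideal.exists_comap_galRestrict_eq ℤ ℚ F (𝓞 F)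
    ((mem_primesOver_span_iff p P.isPrime).2 hP) ((mem_primesOver_span_iff p Q.isPrime).2 hQ)
  refine ⟨s, IsDedekindDomain.HeightOneSpectrum.ext ?_⟩
  rw [← hs]
  ext x
  rw [mem_primeComap, Ideal.mem_comap]
  have h : NumberField.RingOfIntegers.mapRingEquiv s.toRingEquiv x =
      galRestrict ℤ ℚ F (𝓞 F) s x :=
    NumberField.RingOfIntegers.ext (algebraMap_galRestrict_apply ℤ s x).symm
  rw [h]

variable [NumberField.IsCMField F]

theorem regulatorOf_apply {I : Type*} (ℓ : I → (Additive (pUnits p F) →+ ℂ_[p]))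
    (x : ℂ_[p] ⊗[ℚ] minusPart p F) (i : I) :
    regulatorOf p ℓ x i =
      LinearMap.liftBaseChange ℂ_[p] (evalQ p (ℓ i) ∘ₗ (minusPart p F).subtype) x := by
  induction x using TensorProduct.induction_on with
  | zero => simp
  | tmul c v => rfl
  | add x y hx hy => rw [map_add, map_add, Pi.add_apply, hx, hy]

/-- `U⁻` is finite-dimensional, as it is detected by the finitely many valuations above `p`. -/
instance finiteDimensional_minusPart : FiniteDimensional ℚ (minusPart p F) := by
  have hfin : Finite {P : IsDedekindDomain.HeightOneSpectrum (𝓞 F) // (p : 𝓞 F) ∈ P.asIdeal} := by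
    have : Finite ((Ideal.span {(p : ℤ)}).primesOver (𝓞 F)) := by
      have : (Ideal.span {(p : ℤ)}).IsMaximal := Int.ideal_span_isMaximal_of_prime p
      exact (IsDedekindDomain.primesOver_finite (Ideal.span {(p : ℤ)}) (𝓞 F)).to_subtype
    refine Finite.of_injective (β := (Ideal.span {(p : ℤ)}).primesOver (𝓞 F))
      (fun P => ⟨P.1.asIdeal, (mem_primesOver_span_iff p P.1.isPrime).2 P.2⟩) fun P Q h => ?_
    exact Subtype.ext (IsDedekindDomain.HeightOneSpectrum.ext (congrArg Subtype.val h))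
  refine FiniteDimensional.of_injective (LinearMap.pi fun P : {P :
    IsDedekindDomain.HeightOneSpectrum (𝓞 F) // (p : 𝓞 F) ∈ P.asIdeal} =>
      evalQ p (ordAt p P.1) ∘ₗ (minusPart p F).subtype) ?_
  rw [← LinearMap.ker_eq_bot, LinearMap.ker_eq_bot']
  exact fun v hv => eq_zero_of_ordAt_eq_zero p fun P hP => congrFun hv ⟨P, hP⟩

/-- Gross's regulator of a Galois CM field is injective. -/
theorem grossRegulatorGal_injective [IsGalois ℚ F] (hMCC : MatrixCoefficientConjecture p)
    (ι : F →+* ℂ_[p]) : Function.Injective (grossRegulatorGal p ι) := by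
  rw [← LinearMap.ker_eq_bot, LinearMap.ker_eq_bot']
  intro x hx
  let ρ : MonoidAlgebra ℚ (F ≃ₐ[ℚ] F) →ₐ[ℚ] Module.End ℚ (minusPart p F) :=
    MonoidAlgebra.lift ℚ _ _ (minusRep p F)
  have hρ : ∀ g (v : minusPart p F), ρ (MonoidAlgebra.of ℚ _ g) v = minusMap p (g : F →+* F) v :=
    fun g v => by simp only [ρ, MonoidAlgebra.lift_of]; rfl
  -- Each `ℚ_[p]`-embedding `σ` of the completion restricts to `ι ∘ g σ` on `F`.
  let r : (localField p ι →ₐ[ℚ_[p]] ℂ_[p]) → F →+* ℂ_[p] := fun σ =>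
    (σ : localField p ι →+* ℂ_[p]).comp (ι.codRestrict (localField p ι)
      fun x => IntermediateField.subset_adjoin ℚ_[p] _ (Set.mem_range_self x))
  choose g hg using fun σ => exists_algEquiv_of_isGalois ι (r σ)
  let n : MonoidAlgebra ℚ (F ≃ₐ[ℚ] F) := ∑ σ, MonoidAlgebra.of ℚ _ (g σ)
  have hρn : ∀ v : minusPart p F,
      (ρ n v : PUnitsQ p F) = ∑ σ, pUnitsQMap p (g σ : F →+* F) v := fun v => by
    simp only [n, map_sum, LinearMap.sum_apply, hρ, Submodule.coe_sum, coe_minusMap]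
  -- The logarithm of the local norm of `v` is `L (n v)`.
  have hn : (evalQ p (logEmb p ι) ∘ₗ (minusPart p F).subtype) ∘ₗ ρ n =
      evalQ p (logNorm p ι) ∘ₗ (minusPart p F).subtype := by
    refine LinearMap.ext fun v => ?_
    simp only [LinearMap.comp_apply, Submodule.subtype_apply, hρn, map_sum]
    generalize (v : PUnitsQ p F) = w
    induction w using TensorProduct.induction_on with
    | zero => simp
    | tmul q u =>
      simp only [pUnitsQMap_tmul, evalQ_tmul, ← Finset.smul_sum]
      congr 1
      change _ = iwasawaLog p (algebraMap ℚ_[p] ℂ_[p] (localNorm p ι ((u.toMul : Fˣ) : F)))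
      have h1 : ∀ σ, r σ ((u.toMul : Fˣ) : F) ≠ 0 :=
        fun σ => (map_ne_zero (r σ)).2 (Units.ne_zero _)
      rw [algebraMap_localNorm]
      refine Eq.trans ?_ (iwasawaLog_prod p Finset.univ fun σ _ => h1 σ).symm
      refine Finset.sum_congr rfl fun σ _ => ?_
      rw [hg σ]
      rfl
    | add x y hx hy => simp only [map_add, Finset.sum_add_distrib, hx, hy]
  -- The `g σ` fix the prime determined by `ι`, since the `σ` are isometries; so `n` multiplies the
  -- valuation at this prime by the number of the `σ`.
  let o : minusPart p F →ₗ[ℚ] ℚ := evalQ p (ordAt p (primeOf p ι)) ∘ₗ (minusPart p F).subtype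
  have hcomap : ∀ σ, primeComap (g σ).toRingEquiv (primeOf p ι) = primeOf p ι := by
    intro σ
    refine IsDedekindDomain.HeightOneSpectrum.ext (Ideal.ext fun y => ?_)
    rw [mem_primeComap, mem_primeOf, mem_primeOf]
    have h := norm_algHom_apply p (localField p ι) σ
      ⟨ι y, IntermediateField.subset_adjoin ℚ_[p] _ (Set.mem_range_self (y : F))⟩
    have h2 := hg σ y
    change σ ⟨ι y, _⟩ = _ at h2
    rw [h2] at h
    exact Iff.of_eq (congrArg (· < 1) h)
  have ho : ∀ v, o (ρ n v) = Fintype.card (localField p ι →ₐ[ℚ_[p]] ℂ_[p]) * o v := by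
    intro v
    change evalQ p _ (ρ n v : PUnitsQ p F) = _
    have h : ∀ σ, evalQ p (ordAt p (primeOf p ι)) (pUnitsQMap p (g σ : F →+* F) v) = o v := by
      intro σ
      refine (evalQ_ordAt_pUnitsQMap p _ (g σ).toRingEquiv _).trans ?_
      rw [hcomap]
      rfl
    rw [hρn, map_sum, Finset.sum_congr rfl fun σ _ => h σ, Finset.sum_const, nsmul_eq_mul]
    rfl
  have hcard : (Fintype.card (localField p ι →ₐ[ℚ_[p]] ℂ_[p]) : ℚ) ≠ 0 := by
    have : Nonempty (localField p ι →ₐ[ℚ_[p]] ℂ_[p]) := ⟨(localField p ι).val⟩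
    exact_mod_cast Fintype.card_ne_zero
  refine eq_zero_of_matrixCoefficient ρ n (evalQ p (logEmb p ι) ∘ₗ (minusPart p F).subtype)
    (evalQ_logEmb_injective p ι) o (fun v hv => ?_) (fun m M hM hdet => ?_) x fun a => ?_
  · refine eq_zero_of_ordAt_eq_zero p fun Q hQ => ?_
    obtain ⟨s, rfl⟩ := exists_primeComap_eq p (natCast_mem_primeOf p ι) hQ
    have h := hv (MonoidAlgebra.of ℚ _ s)
    rw [map_mul, Module.End.mul_apply, ho, mul_eq_zero, or_iff_right hcard, hρ] at h
    rw [← evalQ_ordAt_pUnitsQMap]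
    exact h
  · obtain ⟨w, v, hw, hv, h⟩ := hMCC m M (fun i j => by
      obtain ⟨v, hv⟩ := hM i j
      rw [← hv]
      exact evalQ_logEmb_mem_logAlg p ι v) hdet
    exact ⟨w, v, hw, hv, by simpa using h⟩
  · rw [map_mul, Module.End.mul_eq_comp, ← LinearMap.comp_assoc, hn,
      liftBaseChange_comp, LinearMap.comp_apply]
    induction a using MonoidAlgebra.induction_on with
    | of s =>
      have h := congrFun hx s⁻¹
      rw [Pi.zero_apply, grossRegulatorGal, regulatorOf_apply, inv_inv] at h
      rw [← h, ← LinearMap.comp_apply, ← liftBaseChange_comp]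
      congr 2
      refine LinearMap.ext fun v => ?_
      simp only [LinearMap.comp_apply, Submodule.subtype_apply, hρ, coe_minusMap, evalQ_pUnitsQMap]
      rfl
    | add a b ha hb =>
      rw [map_add, LinearMap.baseChange_add, LinearMap.add_apply, map_add, ha, hb, add_zero]
    | smul c a ha =>
      rw [map_smul, LinearMap.baseChange_smul, LinearMap.smul_apply, map_rat_smul, ha]
      exact smul_zero c

end Galois

/-! ### Galois closures of CM fields -/

section NormalClosure

open NumberField

/-- The Galois closure `E/ℚ` of a number field `F`: endomorphisms of `E` are determined by their
restrictions to the conjugates of `F`. -/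
theorem exists_galoisClosure.{u} (F : Type u) [Field F] [NumberField F] :
    ∃ (E : Type u) (_ : Field E) (_ : NumberField E) (_ : IsGalois ℚ E) (_ : F →+* E),
      ∀ f g : E →+* E, (∀ (k : F →+* E) (y : F), f (k y) = g (k y)) → f = g := by
  let N := IntermediateField.normalClosure ℚ F (AlgebraicClosure F)
  have hcl : IsAlgClosure ℚ (AlgebraicClosure F) :=
    ⟨inferInstance, Algebra.IsAlgebraic.trans ℚ F _⟩
  have hnorm : Normal ℚ (AlgebraicClosure F) := IsAlgClosure.normal ℚ _
  have hN : Normal ℚ N := normalClosure.normal ℚ F (AlgebraicClosure F)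
  have hgal : IsGalois ℚ N := ⟨⟩
  refine ⟨N, inferInstance, ⟨⟩, by convert! hgal, algebraMap F N, fun f g h => ?_⟩
  let S : IntermediateField ℚ N :=
    (RingHom.eqLocusField f g).toIntermediateField fun q => by
      change f _ = g _
      simp
  have hle : N ≤ IntermediateField.lift S := by
    refine iSup_le fun k => ?_
    rintro _ ⟨y, rfl⟩
    have hk : ∀ y, k y ∈ N := fun y => AlgHom.fieldRange_le_normalClosure k ⟨y, rfl⟩
    let k' : F →+* N := (k : F →+* AlgebraicClosure F).codRestrict _ hk
    exact (IntermediateField.mem_lift (E := S) (k' y)).2 (h k' y)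
  exact RingHom.ext fun x => (IntermediateField.mem_lift (E := S) x).1 (hle x.2)

/-- A Galois closure of a CM field is a CM field: complex conjugation commutes with the Galois
group because it does so on each conjugate of `F`. -/
theorem isCMField_of_galoisClosure {F E : Type*} [Field F] [NumberField F] [IsCMField F] [Field E]
    [NumberField E] [IsGalois ℚ E] (j : F →+* E)
    (hE : ∀ f g : E →+* E, (∀ (k : F →+* E) (y : F), f (k y) = g (k y)) → f = g) :
    IsCMField E := by
  have htc : IsTotallyComplex E := by
    let : Algebra F E := j.toAlgebra
    exact isTotallyComplex_of_algebra F E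
  let φ : E →+* ℂ := Classical.choice inferInstance
  obtain ⟨c, hc⟩ := exists_algEquiv_of_isGalois φ ((starRingEnd ℂ).comp φ)
  have hck : ∀ (k : F →+* E) (y : F), c (k y) = k (IsCMField.complexConj F y) := by
    intro k y
    apply φ.injective
    rw [← hc]
    exact (IsCMField.complexEmbedding_complexConj F (φ.comp k) y).symm
  refine IsCMField.of_forall_isConj E (σ := c) fun ψ => ?_
  obtain ⟨s, hs⟩ := exists_algEquiv_of_isGalois φ ψ
  have hcomm : ((c * s : E ≃ₐ[ℚ] E) : E →+* E) = ((s * c : E ≃ₐ[ℚ] E) : E →+* E) := by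
    refine hE _ _ fun k y => ?_
    change c (s (k y)) = s (c (k y))
    rw [hck k]
    exact hck ((s : E →+* E).comp k) y
  refine RingHom.ext fun x => ?_
  change star (ψ x) = ψ (c x)
  rw [hs, hs]
  exact (hc (s x)).trans (congrArg φ (RingHom.congr_fun hcomm x))

end NormalClosure

/-! ### Local norms in towers -/

section Tower

variable (p : ℕ) [Fact p.Prime] {F E : Type*} [Field F] [Field E]

theorem localField_comp_le (j : F →+* E) (ι : E →+* ℂ_[p]) :
    localField p (ι.comp j) ≤ localField p ι := by
  refine IntermediateField.adjoin.mono _ _ _ ?_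
  rintro _ ⟨x, rfl⟩
  exact ⟨j x, rfl⟩

variable [NumberField F]

/-- The exponent is the degree of the completion of `E` over that of `F`. -/
theorem exists_localNorm_map_eq_pow (j : F →+* E) (ι : E →+* ℂ_[p]) :
    ∃ d : ℕ, ∀ x, localNorm p ι (j x) = localNorm p (ι.comp j) x ^ d := by
  let i := IntermediateField.inclusion (localField_comp_le p j ι)
  let : Algebra (localField p (ι.comp j)) (localField p ι) := i.toAlgebra
  have : IsScalarTower ℚ_[p] (localField p (ι.comp j)) (localField p ι) :=
    IsScalarTower.of_algebraMap_eq fun x => (i.commutes x).symm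
  have : Module.Free (localField p (ι.comp j)) (localField p ι) := Module.Free.of_divisionRing _ _
  refine ⟨Module.finrank (localField p (ι.comp j)) (localField p ι), fun x => ?_⟩
  unfold localNorm
  rw [← map_pow, ← Algebra.norm_algebraMap, Algebra.norm_norm]
  rfl

/-- On `F`, the local norms of an extension `E` have the same logarithms as those of `F`, up to the
local degree. -/
theorem exists_logNorm_comp_eq (j : F →+* E) (ι : E →+* ℂ_[p]) :
    ∃ d : ℕ, (logNorm p ι).comp (pUnitsHom p j) = d • logNorm p (ι.comp j) := by
  obtain ⟨d, hd⟩ := exists_localNorm_map_eq_pow p j ι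
  refine ⟨d, AddMonoidHom.ext fun u => ?_⟩
  rw [AddMonoidHom.nsmul_apply, nsmul_eq_mul]
  change iwasawaLog p (algebraMap ℚ_[p] ℂ_[p] (localNorm p ι (j ((u.toMul : Fˣ) : F)))) =
    d * iwasawaLog p (algebraMap ℚ_[p] ℂ_[p] (localNorm p (ι.comp j) ((u.toMul : Fˣ) : F)))
  rw [hd, map_pow, iwasawaLog_pow]
  exact (map_ne_zero _).2 (localNorm_ne_zero p _ _)

end Tower

/-! ### Injectivity for all CM fields -/

section General

open NumberField

variable (p : ℕ) {F : Type*} [Field F] [NumberField F] [IsCMField F]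

theorem liftBaseChange_evalQ_nsmul {C : Type*} [Field C] [Algebra ℚ C] (d : ℕ)
    (f : Additive (pUnits p F) →+ C) (x : C ⊗[ℚ] minusPart p F) :
    LinearMap.liftBaseChange C (evalQ p (d • f) ∘ₗ (minusPart p F).subtype) x =
      d • LinearMap.liftBaseChange C (evalQ p f ∘ₗ (minusPart p F).subtype) x := by
  have h : ∀ v, evalQ p (d • f) v = d • evalQ p f v := by
    intro v
    induction v using TensorProduct.induction_on with
    | zero => simp
    | tmul q u => rw [evalQ_tmul, evalQ_tmul, AddMonoidHom.nsmul_apply, smul_comm]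
    | add x y hx hy => rw [map_add, map_add, hx, hy, smul_add]
  induction x using TensorProduct.induction_on with
  | zero => simp
  | tmul c v => simp [h, mul_left_comm]
  | add x y hx hy => rw [map_add, map_add, hx, hy, smul_add]

variable [Fact p.Prime]

/-- Gross's regulator of a CM field `F` is injective, since the regulator of a Galois closure vanishes
on its kernel. -/
theorem grossRegulator_injective (hMCC : MatrixCoefficientConjecture p) :
    Function.Injective (grossRegulator p F) := by
  rw [← LinearMap.ker_eq_bot, LinearMap.ker_eq_bot']
  intro x hx
  obtain ⟨E, _, _, _, j, hE⟩ := exists_galoisClosure F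
  have := isCMField_of_galoisClosure j hE
  let ι : E →+* ℂ_[p] := Classical.choice inferInstance
  have hinj : Function.Injective ((minusMap p j).baseChange ℂ_[p]) :=
    Module.Flat.lTensor_preserves_injective_linearMap _ (minusMap_injective p j)
  refine hinj ?_
  rw [map_zero]
  apply grossRegulatorGal_injective p hMCC ι
  rw [map_zero]
  funext τ
  let k : F →+* E := ((τ⁻¹ : E ≃ₐ[ℚ] E) : E →+* E).comp j
  obtain ⟨d, hd⟩ := exists_logNorm_comp_eq p k ι
  have h := congrFun hx (ι.comp k)
  rw [grossRegulator, regulatorOf_apply, Pi.zero_apply] at h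
  rw [grossRegulatorGal, regulatorOf_apply, ← LinearMap.comp_apply, ← liftBaseChange_comp,
    Pi.zero_apply, ← nsmul_zero d, ← h, ← liftBaseChange_evalQ_nsmul, ← hd]
  congr 2
  refine LinearMap.ext fun v => ?_
  simp only [LinearMap.comp_apply, Submodule.subtype_apply, coe_minusMap, evalQ_pUnitsQMap]
  rfl

end General

/-! ### Existence of `p`-units -/

section PUnitsExist

open NumberField IsDedekindDomain

variable (p : ℕ) [Fact p.Prime] {F : Type*} [Field F]

theorem under_mem_realPrimesAbove {P : HeightOneSpectrum (𝓞 F)} (hP : (p : 𝓞 F) ∈ P.asIdeal) :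
    P.asIdeal.under (𝓞 (maximalRealSubfield F)) ∈ realPrimesAbove p F := by
  refine (mem_primesOver_span_iff p (P.isPrime.under _)).2 ?_
  rw [Ideal.under_def, Ideal.mem_comap, map_natCast]
  exact hP

variable [NumberField F]

/-- For `P` above `p` there is a `p`-unit whose valuation is nonzero exactly at `P`: a generator of a
principal power of `P`, which exists because the class group is finite. -/
theorem exists_pUnit_ordAt {P : HeightOneSpectrum (𝓞 F)} (hP : (p : 𝓞 F) ∈ P.asIdeal) :
    ∃ u : Additive (pUnits p F), ∀ Q, ordAt p Q u = 0 ↔ Q ≠ P := by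
  obtain ⟨h, hh, hprin⟩ : ∃ h : ℕ, h ≠ 0 ∧ (P.asIdeal ^ h).IsPrincipal := by
    refine ⟨Fintype.card (ClassGroup (𝓞 F)), Fintype.card_ne_zero, ?_⟩
    have h0 := mem_nonZeroDivisors_of_ne_zero P.ne_bot
    rw [← ClassGroup.mk0_eq_one_iff (pow_mem h0 _)]
    exact (map_pow ClassGroup.mk0 (⟨P.asIdeal, h0⟩ : nonZeroDivisors (Ideal (𝓞 F))) _).trans
      pow_card_eq_one
  obtain ⟨a, ha⟩ := hprin.principal
  have ha' : P.asIdeal ^ h = Ideal.span {a} := ha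
  have hdvd : a ∣ (p : 𝓞 F) ^ h := by
    rw [← Ideal.mem_span_singleton, ← ha']
    exact Ideal.pow_mem_pow hP h
  obtain ⟨b, hb⟩ := hdvd
  have hp0 : (p : F) ≠ 0 := by exact_mod_cast (Fact.out : p.Prime).ne_zero
  have hbF : (p : F) ^ h = algebraMap (𝓞 F) F a * algebraMap (𝓞 F) F b := by
    rw [← map_mul, ← hb, map_pow, map_natCast]
  have ha0 : algebraMap (𝓞 F) F a ≠ 0 := by
    intro h0
    rw [h0, zero_mul] at hbF
    exact pow_ne_zero h hp0 hbF
  have hinv : (algebraMap (𝓞 F) F a)⁻¹ = algebraMap (𝓞 F) F b * ((p : F)⁻¹) ^ h := by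
    rw [inv_pow, hbF]
    have hb0 : algebraMap (𝓞 F) F b ≠ 0 := by
      intro h0
      rw [h0, mul_zero] at hbF
      exact pow_ne_zero h hp0 hbF
    field_simp
  let α : pUnits p F := ⟨Units.mk0 _ ha0, (Submonoid.mem_units_iff _ _).2
    ⟨Subalgebra.algebraMap_mem (Algebra.adjoin (𝓞 F) {((p : F))⁻¹}) a, by
      rw [Units.val_inv_eq_inv_val, Units.val_mk0, hinv]
      exact mul_mem (Subalgebra.algebraMap_mem (Algebra.adjoin (𝓞 F) {((p : F))⁻¹}) b)
        (pow_mem (Algebra.subset_adjoin (Set.mem_singleton _)) h)⟩⟩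
  refine ⟨Additive.ofMul α, fun Q => ?_⟩
  rw [ordAt_eq_zero_iff]
  change Q.valuation F (algebraMap (𝓞 F) F a) = 1 ↔ _
  rw [HeightOneSpectrum.valuation_eq_one_iff_notMem, not_iff_not,
    ← Ideal.span_singleton_le_iff_mem, ← ha', Q.isPrime.pow_le_iff hh]
  constructor
  · intro hle
    exact (HeightOneSpectrum.ext (P.isMaximal.eq_of_le Q.isPrime.ne_top hle)).symm
  · rintro rfl
    exact le_rfl

end PUnitsExist

/-! ### The dimension of the minus part -/

section Dimension

open NumberField IsDedekindDomain

variable (p : ℕ) {F : Type*} [Field F] [NumberField F] [IsCMField F]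

/-- The complex conjugate `c(P)` of a prime of a CM field. -/
def conjPrime (P : HeightOneSpectrum (𝓞 F)) : HeightOneSpectrum (𝓞 F) :=
  primeComap (IsCMField.complexConj F).toRingEquiv P

theorem evalQ_ordAt_conjPrime (P : HeightOneSpectrum (𝓞 F)) (v : minusPart p F) :
    evalQ p (ordAt p (conjPrime P)) v = -evalQ p (ordAt p P) v := by
  have h := congrArg (evalQ p (ordAt p P)) ((mem_minusPart_iff p).1 v.2)
  rw [map_add, map_zero] at h
  exact (evalQ_ordAt_pUnitsQMap p P (IsCMField.complexConj F).toRingEquiv v).symm.trans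
    (eq_neg_of_add_eq_zero_left h)

theorem under_conjPrime (P : HeightOneSpectrum (𝓞 F)) :
    (conjPrime P).asIdeal.under (𝓞 (maximalRealSubfield F)) =
      P.asIdeal.under (𝓞 (maximalRealSubfield F)) := by
  ext x
  rw [Ideal.under_def, Ideal.under_def, Ideal.mem_comap, Ideal.mem_comap, conjPrime,
    mem_primeComap]
  have h : RingOfIntegers.mapRingEquiv (IsCMField.complexConj F).toRingEquiv
      (algebraMap (𝓞 (maximalRealSubfield F)) (𝓞 F) x) = algebraMap _ _ x :=
    RingOfIntegers.ext (IsCMField.complexConj_apply_eq_self F (x : maximalRealSubfield F))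
  rw [h]

/-- Two primes of `F` over the same prime of `F⁺` are equal or complex conjugate. -/
theorem eq_or_eq_conjPrime {P Q : HeightOneSpectrum (𝓞 F)}
    (h : P.asIdeal.under (𝓞 (maximalRealSubfield F)) =
      Q.asIdeal.under (𝓞 (maximalRealSubfield F))) : Q = P ∨ Q = conjPrime P := by
  obtain ⟨s, hs⟩ := Ideal.exists_comap_galRestrict_eq (𝓞 (maximalRealSubfield F))
    (maximalRealSubfield F) F (𝓞 F) (p := P.asIdeal.under (𝓞 (maximalRealSubfield F)))
    (P₁ := P.asIdeal) (P₂ := Q.asIdeal) ⟨P.isPrime, ⟨rfl⟩⟩ ⟨Q.isPrime, ⟨h⟩⟩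
  classical
  have hs' : s = 1 ∨ s = IsCMField.complexConj F := by
    have hmem : s ∈ Subgroup.zpowers (IsCMField.complexConj F) := by
      rw [IsCMField.zpowers_complexConj_eq_top]
      trivial
    rw [mem_zpowers_iff_mem_range_orderOf, IsCMField.orderOf_complexConj] at hmem
    simpa [Finset.range_add_one, or_comm, eq_comm] using hmem
  rcases hs' with rfl | rfl
  · left
    refine HeightOneSpectrum.ext ?_
    rw [← hs, map_one]
    rfl
  · right
    refine HeightOneSpectrum.ext ?_
    rw [← hs]
    ext x
    rw [conjPrime, mem_primeComap, Ideal.mem_comap]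
    have h : RingOfIntegers.mapRingEquiv (IsCMField.complexConj F).toRingEquiv x =
        galRestrict (𝓞 (maximalRealSubfield F)) (maximalRealSubfield F) F (𝓞 F)
          (IsCMField.complexConj F) x :=
      RingOfIntegers.ext (algebraMap_galRestrict_apply (𝓞 (maximalRealSubfield F)) _ x).symm
    rw [h]

/-- Below a prime which is not its own conjugate, the prime of `F⁺` splits. -/
theorem splitsInCM_under {P : HeightOneSpectrum (𝓞 F)} (h : conjPrime P ≠ P) :
    SplitsInCM (P.asIdeal.under (𝓞 (maximalRealSubfield F))) := by
  have h2 : (P.asIdeal.under (𝓞 (maximalRealSubfield F))).primesOver (𝓞 F) =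
      {P.asIdeal, (conjPrime P).asIdeal} := by
    ext I
    rw [Set.mem_insert_iff, Set.mem_singleton_iff]
    constructor
    · rintro ⟨hI, ⟨hIP⟩⟩
      have hI0 : I ≠ ⊥ := by
        rintro rfl
        refine P.ne_bot (Ideal.eq_bot_of_comap_eq_bot (R := 𝓞 (maximalRealSubfield F)) ?_)
        rw [← Ideal.under_def, hIP, Ideal.under_def]
        exact Ideal.comap_bot_of_injective _ (FaithfulSMul.algebraMap_injective _ _)
      rcases eq_or_eq_conjPrime (Q := ⟨I, hI, hI0⟩) hIP with h | h
      · exact Or.inl (congrArg HeightOneSpectrum.asIdeal h)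
      · exact Or.inr (congrArg HeightOneSpectrum.asIdeal h)
    · rintro (rfl | rfl)
      · exact ⟨P.isPrime, ⟨rfl⟩⟩
      · exact ⟨(conjPrime P).isPrime, ⟨(under_conjPrime P).symm⟩⟩
  rw [SplitsInCM, h2, Set.ncard_pair]
  exact fun h3 => h (HeightOneSpectrum.ext h3.symm)

variable [Fact p.Prime]

/-- A prime of `F⁺` that splits in `F` lies below a prime which is not its own conjugate. -/
theorem exists_of_splitsInCM {v : Ideal (𝓞 (maximalRealSubfield F))}
    (hv : v ∈ realPrimesAbove p F) (hs : SplitsInCM v) :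
    ∃ P : HeightOneSpectrum (𝓞 F), (p : 𝓞 F) ∈ P.asIdeal ∧ conjPrime P ≠ P ∧
      P.asIdeal.under (𝓞 (maximalRealSubfield F)) = v := by
  have hp : (p : 𝓞 (maximalRealSubfield F)) ∈ v := (mem_primesOver_span_iff p hv.1).1 hv
  have hup : ∀ I ∈ v.primesOver (𝓞 F), (p : 𝓞 F) ∈ I := by
    rintro I ⟨-, ⟨hI⟩⟩
    rw [hI, Ideal.under_def, Ideal.mem_comap, map_natCast] at hp
    exact hp
  have hbot : ∀ I ∈ v.primesOver (𝓞 F), I ≠ ⊥ := by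
    rintro I hI rfl
    exact (Fact.out : p.Prime).ne_zero (by exact_mod_cast (Ideal.mem_bot.1 (hup _ hI)))
  obtain ⟨I, J, hIJ, hset⟩ := Set.ncard_eq_two.1 hs
  have hI : I ∈ v.primesOver (𝓞 F) := by simp [hset]
  have hJ : J ∈ v.primesOver (𝓞 F) := by simp [hset]
  let P : HeightOneSpectrum (𝓞 F) := ⟨I, hI.1, hbot I hI⟩
  let Q : HeightOneSpectrum (𝓞 F) := ⟨J, hJ.1, hbot J hJ⟩
  refine ⟨P, hup I hI, fun h => ?_, hI.2.over.symm⟩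
  rcases eq_or_eq_conjPrime (P := P) (Q := Q) (hI.2.over.symm.trans hJ.2.over) with h1 | h1
  · exact hIJ (congrArg HeightOneSpectrum.asIdeal h1).symm
  · exact hIJ (congrArg HeightOneSpectrum.asIdeal (h1.trans h)).symm

/-- The dimension of `U⁻` is the number of primes of `F⁺` above `p` that split in `F`. -/
theorem finrank_minusPart : Module.finrank ℚ (minusPart p F) =
    {v ∈ realPrimesAbove p F | SplitsInCM v}.ncard := by
  classical
  have hmax : (Ideal.span {(p : ℤ)}).IsMaximal := Int.ideal_span_isMaximal_of_prime p
  have hfin : {v ∈ realPrimesAbove p F | SplitsInCM v}.Finite :=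
    (IsDedekindDomain.primesOver_finite (Ideal.span {(p : ℤ)}) _).subset fun v hv => hv.1
  let S := {v ∈ realPrimesAbove p F | SplitsInCM v}
  have : Fintype S := hfin.fintype
  choose P hPp hPc hPv using fun v : S => exists_of_splitsInCM p v.2.1 v.2.2
  -- `Φ` records the valuation at one of the two primes above each split prime.
  let Φ : minusPart p F →ₗ[ℚ] S → ℚ :=
    LinearMap.pi fun v => evalQ p (ordAt p (P v)) ∘ₗ (minusPart p F).subtype
  have hinj : Function.Injective Φ := by
    rw [← LinearMap.ker_eq_bot, LinearMap.ker_eq_bot']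
    intro x hx
    refine eq_zero_of_ordAt_eq_zero p fun Q hQ => ?_
    by_cases hc : conjPrime Q = Q
    · have h := evalQ_ordAt_conjPrime p Q x
      rw [hc] at h
      linarith
    · let v : S := ⟨_, under_mem_realPrimesAbove p hQ, splitsInCM_under hc⟩
      have hv : evalQ p (ordAt p (P v)) x = 0 := congrFun hx v
      rcases eq_or_eq_conjPrime (P := P v) (Q := Q) (hPv v) with h | h
      · rw [h, hv]
      · rw [h, evalQ_ordAt_conjPrime, hv, neg_zero]
  have hsurj : Function.Surjective Φ := by
    rw [← LinearMap.range_eq_top, eq_top_iff, ← (Pi.basisFun ℚ S).span_eq, Submodule.span_le]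
    rintro _ ⟨v, rfl⟩
    -- `u / c u`, for `u` with valuation concentrated at `P v`, is a multiple of a basis vector.
    obtain ⟨u, hu⟩ := exists_pUnit_ordAt p (hPp v)
    let c : F →+* F := (IsCMField.complexConj F : F →+* F)
    have hcc : c.comp c = RingHom.id F := RingHom.ext (IsCMField.complexConj_apply_apply F)
    let x : minusPart p F := ⟨1 ⊗ₜ u - pUnitsQMap p c (1 ⊗ₜ u), by
      rw [mem_minusPart_iff, map_sub, ← pUnitsQMap_comp, hcc, pUnitsQMap_id]
      abel⟩
    have hx : ∀ w, Φ x w = ordAt p (P w) u - ordAt p (conjPrime (P w)) u := by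
      intro w
      change evalQ p (ordAt p (P w)) (1 ⊗ₜ u - pUnitsQMap p c (1 ⊗ₜ u)) = _
      rw [map_sub, evalQ_tmul, one_smul]
      congr 1
      refine (evalQ_ordAt_pUnitsQMap p (P w) (IsCMField.complexConj F).toRingEquiv _).trans ?_
      rw [evalQ_tmul, one_smul]
      rfl
    have hne : ∀ w, conjPrime (P w) ≠ P v := by
      intro w h
      have hwv : w = v := by
        refine Subtype.ext ?_
        rw [← hPv w, ← hPv v, ← h, under_conjPrime]
      rw [hwv] at h
      exact hPc v h
    refine ⟨(ordAt p (P v) u)⁻¹ • x, funext fun w => ?_⟩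
    rw [map_smul, Pi.smul_apply, hx, (hu _).2 (hne w), sub_zero, smul_eq_mul, Pi.basisFun_apply]
    by_cases hwv : w = v
    · rw [hwv, Pi.single_eq_same, inv_mul_cancel₀]
      exact fun h => (hu _).1 h rfl
    · rw [Pi.single_eq_of_ne hwv, (hu (P w)).2, mul_zero]
      intro h
      refine hwv (Subtype.ext ?_)
      rw [← hPv w, h, hPv v]
  rw [(LinearEquiv.ofBijective Φ ⟨hinj, hsurj⟩).finrank_eq, Module.finrank_fintype_fun_eq_card,
    ← Nat.card_eq_fintype_card]
  rfl

theorem finrank_range_of_injective {I : Type*} {f : ℂ_[p] ⊗[ℚ] minusPart p F →ₗ[ℂ_[p]] (I → ℂ_[p])}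
    (hf : Function.Injective f) : Module.finrank ℂ_[p] (LinearMap.range f) =
      {v ∈ realPrimesAbove p F | SplitsInCM v}.ncard := by
  rw [LinearMap.finrank_range_of_inj hf, Module.finrank_baseChange, finrank_minusPart]

end Dimension

end GrossKuzmin

end

theorem theorem4 (p : ℕ) [Fact p.Prime]
    (hMCC : GrossKuzmin.MatrixCoefficientConjecture p)
    (F : Type*) [Field F] [NumberField F] [NumberField.IsCMField F] :
    (Function.Injective (GrossKuzmin.grossRegulator p F) ∧
      Module.finrank ℂ_[p] (LinearMap.range (GrossKuzmin.grossRegulator p F)) =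
        {v ∈ GrossKuzmin.realPrimesAbove p F | GrossKuzmin.SplitsInCM v}.ncard) ∧
    (IsGalois ℚ F → ∀ ι : F →+* ℂ_[p],
      Function.Injective (GrossKuzmin.grossRegulatorGal p ι) ∧
      ((∀ v ∈ GrossKuzmin.realPrimesAbove p F, GrossKuzmin.SplitsInCM v) →
        Module.finrank ℂ_[p] (LinearMap.range (GrossKuzmin.grossRegulatorGal p ι)) =
          (GrossKuzmin.realPrimesAbove p F).ncard)) := by
  have h1 := GrossKuzmin.grossRegulator_injective (F := F) p hMCC
  refine ⟨⟨h1, GrossKuzmin.finrank_range_of_injective p h1⟩, fun _ ι => ?_⟩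
  have h2 := GrossKuzmin.grossRegulatorGal_injective p hMCC ι
  refine ⟨h2, fun hs => ?_⟩
  rw [GrossKuzmin.finrank_range_of_injective p h2, Set.sep_eq_self_iff_mem_true.2 hs]
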